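/- **Setting.** Use coordinates $(x_1,x_2)$ of $\mathbb R^2$ along the lattice vectors $e_1,e_2$; put $e_3=-e_1-e_2$. For $\delta>0$ the triangular lattice of mesh $\delta$ is $\mathcal T_\delta=\delta\mathbb Z e_1+\delta\mathbb Z e_2$, with nearest neighbours $x\pm\delta e_k$, $k=1,2,3$. For $D\subset\mathbb R^2$ let $D^\delta=D\cap\mathcal T_\delta$; for $A\subset\mathcal T_\delta$ let $\partial A$ be the set of $x\in A$ with a neighbour outside $A$. A height function on $A$ is a map $h:A\to\delta\mathbb Z$ such that, for $x,y\in A$, $h(x)-h(y)\in\{-\delta,0\}$ if $x-y\in\{\delta e_1,\delta e_2\}$, and $h(x)-h(y)\in\{0,\delta\}$ if $x-y=\delta e_3$. For $g$ defined on $\partial A$, $\Omega_{A,g}$ is the set of height functions on $A$ equal to $g$ on $\partial A$. The Glauber dynamics on $A$ constrained between $h^-$ and $h^+$ is the continuous-time Markov process in which every vertex of $A\setminus\partial A$ carries an independent mean-one Poisson clock; when the clock at $x$ rings, $h(x)$ is resampled uniformly among its admissible values given the heights at the other vertices, except that an update violating $h^-(x)\le h(x)\le h^+(x)$ is discarded.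 The heights on $\partial A$ never change. Let $\mathbb T$ be the closed triangle with vertices $(0,0),(-1,0),(0,-1)$ and, for $p\in\mathbb T$, let $$\sigma(p)=-\tfrac1\pi\big(L(-\pi p_1)+L(-\pi p_2)+L(\pi(1+p_1+p_2))\big),\qquad L(\theta)=-\int_0^\theta\log|2\sin s|\,ds,$$ with second derivatives $\sigma_{jk}$ in the interior of $\mathbb T$. A $C^2$ function $u$ solves (EL) in an open set if there $\nabla u$ lies in the interior of $\mathbb T$ and $\sum_{j,k=1}^2\sigma_{jk}(\nabla u)\,\partial^2_{x_jx_k}u=0$. Let $U,W\subset\mathbb R^2$ be bounded, simply connected, open domains whose boundaries are Jordan curves, with $\overline W\subset U$. Let $\phi:U\to\mathbb R$ be $C^\infty$ and solve (EL) in $U$, with $\nabla\phi$ at Euclidean distance at least $a>0$ from $\partial\mathbb T$. Let $K>0$ and $\xi>0$, and let $\psi(x)=c-e^{x_1/\xi}-e^{x_2/\xi}$ with $c$ such that $\inf_U\psi=1$. For $\epsilon_0,\eta,\delta>0$ and integers $i\ge0$ set $$\epsilon_i=\epsilon_0-\delta i,\quad r_i=\sqrt{\delta^{1-\eta}/\epsilon_i},\quad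 t_0=\delta^{-2-\eta},\quad t_{i+1}-t_i=(r_i/\delta)^2\delta^{-5\eta},\quad i_{max}=\lfloor(\epsilon_0-\delta^{1-4\eta})/\delta\rfloor.$$ For $w\in W^\delta$ let $Q_w(x)=-\langle x-w,\nabla^2\psi(w)(x-w)\rangle$, $E_{i,w}=\{Q_w\le r_i^2\}$ and $E^{1/2}_{i,w}=\{Q_w\le r_i^2/4\}$. Let $\phi_{i,w}$ be the solution of (EL) in the interior of $E_{i,w}$ that is continuous on $E_{i,w}$, with boundary values on $\partial E_{i,w}$ $$\phi(x)+\epsilon_i\big(\psi(w)-\tfrac12r_i^2+\langle\nabla\psi(w),x-w\rangle\big).$$ **Proposition.** There is $\bar\epsilon>0$ (depending on $U,W,\phi,K,\xi$) such that for all $\epsilon_0\in(0,\bar\epsilon)$ and $\eta>0$ there is $\delta_0>0$ such that the following holds for all $\delta\in(0,\delta_0)$, all integers $0\le i\le i_{max}$, all $w\in W^\delta$ (including $w$ near the boundary), and every $\phi^\delta:U^\delta\to\delta\mathbb Z$ with $|\phi^\delta-\phi|\le K\delta$ on $U^\delta$ and $\Omega_{W^\delta,\phi^\delta|_{\partial W^\delta}}\ne\emptyset$.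 There are a greatest element $h^{(i)}_{max}$ of $\{h\in\Omega_{W^\delta,\phi^\delta|_{\partial W^\delta}}:h\le\phi+\epsilon_i\psi\}$ and a greatest height function $h^{(i,w)}_{max}$ on $(E^{1/2}_{i,w})^\delta$ that is $\le\phi+\epsilon_i\psi$. Let $\hat{\mathbb P}$ be the law of the Glauber dynamics on $W^\delta$ started from $h^{(i)}_{max}$ and constrained between $\phi-\epsilon_i\psi$ and $\phi+\epsilon_i\psi$. Let $\tilde{\mathbb P}_{i,w}$ be the law of the Glauber dynamics on $(E^{1/2}_{i,w})^\delta$ started from $h^{(i,w)}_{max}$ (so with boundary heights fixed to $h^{(i,w)}_{max}$) and constrained between $\phi_{i,w}-\delta^{1-2\eta}$ and $\phi+\epsilon_i\psi$. Then $$\hat{\mathbb P}\big(h_t(w)<\phi(w)+\epsilon_{i+1}\psi(w)\ \ \forall t\in[t_{i+1}-t_i,\delta^{-5}-t_i]\big)\ \ge\ \tilde{\mathbb P}_{i,w}\big(h_t(w)<\phi(w)+\epsilon_{i+1}\psi(w)\ \ \forall t\in[t_{i+1}-t_i,\delta^{-5}-t_i]\big).$$ -/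

import Mathlib

open Set MeasureTheory ProbabilityTheory
open scoped ENNReal ContDiff

noncomputable section

namespace Lozenge

/-! ### Calculus in the plane, surface tension, Euler-Lagrange equation -/

/-- The plane, with coordinates `(x 0, x 1)` along the lattice vectors `e₁, e₂`. -/
abbrev Plane : Type := EuclideanSpace ℝ (Fin 2)

/-- The `j`-th partial derivative. -/
def pd (j : Fin 2) (f : Plane → ℝ) (x : Plane) : ℝ :=
  fderiv ℝ f x (EuclideanSpace.single j 1)

/-- The gradient. -/
def grad (f : Plane → ℝ) (x : Plane) : Plane := !₂[pd 0 f x, pd 1 f x]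

/-- The Newton polygon: the triangle with vertices `(0,0)`, `(-1,0)`, `(0,-1)`. -/
def newton : Set Plane := convexHull ℝ {!₂[(0 : ℝ), 0], !₂[(-1 : ℝ), 0], !₂[(0 : ℝ), -1]}

/-- The Lobachevsky function `L(θ) = -∫₀^θ log |2 sin s| ds`. -/
def lobachevsky (θ : ℝ) : ℝ := -∫ s in (0 : ℝ)..θ, Real.log |2 * Real.sin s|

/-- The surface tension of lozenge tilings at slope `p`, that is, minus the entropy per vertex.
The three lozenge densities are `-p 0`, `-p 1`, `1 + p 0 + p 1`. Only the values of this formula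
in the Newton polygon are meaningful (outside of it the surface tension is `+∞`). -/
def sigma (p : Plane) : ℝ :=
  -(1 / Real.pi) * (lobachevsky (Real.pi * (-p 0)) + lobachevsky (Real.pi * (-p 1)) +
    lobachevsky (Real.pi * (1 + p 0 + p 1)))

/-- `u` solves `∑ σ_{jk}(∇u) ∂²_{jk} u = 0` in `D`, with slopes in the interior of the Newton
polygon (where `σ` is smooth). -/
def SolvesEL (D : Set Plane) (u : Plane → ℝ) : Prop :=
  ∀ x ∈ D, grad u x ∈ interior newton ∧
    ∑ j : Fin 2, ∑ k : Fin 2, pd j (pd k sigma) (grad u x) * pd j (pd k u) x = 0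

/-- `u` is the limit shape in the closed region `E` with boundary values `f`: the classical
solution of the Euler-Lagrange equation, continuous up to the boundary. -/
structure IsLimitShape (E : Set Plane) (f u : Plane → ℝ) : Prop where
  continuousOn : ContinuousOn u E
  contDiffOn : ContDiffOn ℝ 2 u (interior E)
  solves : SolvesEL (interior E) u
  boundary : ∀ x ∈ frontier E, u x = f x

/-- A bounded, simply connected, open domain whose boundary is a Jordan curve. -/
structure IsJordanDomain (D : Set Plane) : Prop where
  isOpen : IsOpen D
  bounded : Bornology.IsBounded D
  simplyConnected : IsSimplyConnected D
  jordan : ∃ γ : Circle → Plane, Continuous γ ∧ Function.Injective γ ∧ range γ = frontier D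

/-- `φ` is a smooth limit shape in `U` without frozen regions, with slopes at Euclidean distance
at least `a` from the boundary of the Newton polygon. -/
structure IsLiquidShape (U : Set Plane) (a : ℝ) (φ : Plane → ℝ) : Prop where
  smooth : ContDiffOn ℝ ∞ φ U
  solves : SolvesEL U φ
  nonfrozen : ∀ x ∈ U, a ≤ Metric.infDist (grad φ x) (frontier newton)

/-! ### Lattice and height functions -/

/-- Vertices of the triangular lattice: `(m, n)` stands for `m e₁ + n e₂`. -/
abbrev Vertex : Type := ℤ × ℤ

/-- The position in the plane of a vertex of the lattice with mesh `δ`. -/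
def pos (δ : ℝ) (z : Vertex) : Plane := !₂[δ * z.1, δ * z.2]

def e₁ : Vertex := (1, 0)
def e₂ : Vertex := (0, 1)
/-- The third elementary vector: `e₁ + e₂ + e₃ = 0`. -/
def e₃ : Vertex := (-1, -1)

/-- Nearest neighbours in the triangular lattice. -/
def Nbr (x y : Vertex) : Prop :=
  x - y ∈ ({e₁, e₂, e₃} : Set Vertex) ∨ y - x ∈ ({e₁, e₂, e₃} : Set Vertex)

/-- The discretization of `D`: the vertices of the lattice with mesh `δ` contained in `D`. -/
def sites (δ : ℝ) (D : Set Plane) : Set Vertex := {z | pos δ z ∈ D}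

/-- The boundary of `A`: the vertices in `A` with a neighbour outside `A`. -/
def bdry (A : Set Vertex) : Set Vertex := {x ∈ A | ∃ y, Nbr x y ∧ y ∉ A}

/-- Admissible height functions on `A`. Heights are measured in units of `δ`: the integer `h x`
stands for the height `δ * h x` in `δℤ`. -/
def IsHeight (A : Set Vertex) (h : A → ℤ) : Prop :=
  ∀ x y : A,
    ((x : Vertex) - y = e₁ ∨ (x : Vertex) - y = e₂ → h x - h y ∈ ({-1, 0} : Set ℤ)) ∧
    ((x : Vertex) - y = e₃ → h x - h y ∈ ({0, 1} : Set ℤ))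

/-- Height functions on `A` that coincide with `g` on the boundary of `A`. -/
def Omega (A : Set Vertex) (g : Vertex → ℤ) : Set (A → ℤ) :=
  {h | IsHeight A h ∧ ∀ x : A, (x : Vertex) ∈ bdry A → h x = g x}

/-- `δ g` is a `K`-discretization of `f : D → ℝ`. -/
def IsDiscretization (K δ : ℝ) (D : Set Plane) (f : Plane → ℝ) (g : Vertex → ℤ) : Prop :=
  ∀ z ∈ sites δ D, |δ * g z - f (pos δ z)| ≤ K * δ

/-! ### Constrained Glauber dynamics, through its Poisson clocks -/

/-- A realization of all clocks: for each vertex `x` and each `n`, the waiting time between the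
rings number `n - 1` and `n` of the clock at `x`, and a coin for ring number `n`. -/
abbrev Clocks : Type := Vertex × ℕ → ℝ × Bool

instance : IsProbabilityMeasure (expMeasure 1) := isProbabilityMeasure_expMeasure one_pos

/-- The clocks are independent mean-one Poisson clocks (i.i.d. exponential waiting times), and
the coins are fair and independent of everything else. -/
def clockLaw : Measure Clocks :=
  Measure.infinitePi fun _ => (expMeasure 1).prod (PMF.uniformOfFintype Bool).toMeasure

/-- The time of ring number `n` (counted from `0`) of the clock at `x`. -/
def ringTime (ζ : Clocks) (x : Vertex) (n : ℕ) : ℝ := ∑ k ∈ Finset.range (n + 1), (ζ (x, k)).1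

/-- A ring is recorded as (time, vertex, number), ordered lexicographically, so first by time. -/
abbrev ClockRing : Type := ℝ ×ₗ (ℤ ×ₗ (ℤ ×ₗ ℕ))

def mkRing (s : ℝ) (x : Vertex) (n : ℕ) : ClockRing := toLex (s, toLex (x.1, toLex (x.2, n)))

def ringVertex (r : ClockRing) : Vertex :=
  ((ofLex (ofLex r).2).1, (ofLex (ofLex (ofLex r).2).2).1)

def ringIndex (r : ClockRing) : ℕ := (ofLex (ofLex (ofLex r).2).2).2

/-- The rings up to time `t` of the clocks in `A \ ∂A`. -/
def rings (A : Set Vertex) (ζ : Clocks) (t : ℝ) : Set ClockRing :=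
  {r | ∃ x ∈ A \ bdry A, ∃ n, ringTime ζ x n ≤ t ∧ r = mkRing (ringTime ζ x n) x n}

/-- The height function `h`, with its value at `x` replaced by `v`. -/
def setAt {A : Set Vertex} (h : A → ℤ) (x : Vertex) (v : ℤ) : A → ℤ :=
  fun y => if (y : Vertex) = x then v else h y

/-- The possible values at `x` of an admissible height function that equals `h` elsewhere. For
admissible `h` and `x ∈ A \ ∂A` these are one or two consecutive integers. -/
def values {A : Set Vertex} (h : A → ℤ) (x : Vertex) : Set ℤ := {v | IsHeight A (setAt h x v)}

/-- The resampled value at `x`: a fair coin chooses between the largest and the smallest possible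
value, which is the uniform choice as there are one or two possible values. -/
def resample {A : Set Vertex} (h : A → ℤ) (x : Vertex) (b : Bool) : ℤ :=
  if b then sSup (values h x) else sInf (values h x)

open Classical in
/-- Update at `x` of the dynamics constrained between `lo` and `up`: an update that violates the
constraint is discarded. -/
def censoredUpdate (δ : ℝ) {A : Set Vertex} (lo up : Plane → ℝ) (h : A → ℤ) (x : Vertex) (b : Bool) :
    A → ℤ :=
  if lo (pos δ x) ≤ δ * resample h x b ∧ δ * resample h x b ≤ up (pos δ x) then
    setAt h x (resample h x b)
  else h

open Classical in
/-- The state at time `t` of the Glauber dynamics on `A` constrained between `lo` and `up`, started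
from `h₀`: the updates of all rings up to time `t` are applied in chronological order. (Almost
surely there are finitely many such rings, when `A` is finite.) The heights on the
boundary of `A` never change. -/
def glauber (δ : ℝ) (A : Set Vertex) (lo up : Plane → ℝ) (h₀ : A → ℤ) (ζ : Clocks) (t : ℝ) :
    A → ℤ :=
  if hfin : (rings A ζ t).Finite then
    (hfin.toFinset.sort).foldl
      (fun h r => censoredUpdate δ lo up h (ringVertex r) (ζ (ringVertex r, ringIndex r)).2) h₀
  else h₀

/-- The probability that the constrained dynamics satisfies `h_t(w) < b` for all `t ∈ I`. -/
def probBelow (δ : ℝ) (A : Set Vertex) (lo up : Plane → ℝ) (h₀ : A → ℤ) (w : A) (b : ℝ)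
    (I : Set ℝ) : ℝ≥0∞ :=
  clockLaw {ζ | ∀ t ∈ I, δ * (glauber δ A lo up h₀ ζ t w : ℝ) < b}

/-! ### The concave profile, the ellipses and the scales -/

/-- `ψ(x) = c - e^{x₁/ξ} - e^{x₂/ξ}`. -/
def psi (ξ c : ℝ) (x : Plane) : ℝ := c - Real.exp (x 0 / ξ) - Real.exp (x 1 / ξ)

/-- `Q_w(x) = -⟨x - w, ∇²ψ(w) (x - w)⟩`. -/
def quad (ξ c : ℝ) (w x : Plane) : ℝ :=
  -∑ j : Fin 2, ∑ k : Fin 2, (x j - w j) * pd j (pd k (psi ξ c)) w * (x k - w k)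

/-- The closed ellipse `{Q_w ≤ r²}`. -/
def ellipse (ξ c : ℝ) (w : Plane) (r : ℝ) : Set Plane := {x | quad ξ c w x ≤ r ^ 2}

theorem center_mem (ξ c δ r : ℝ) (w : Vertex) : w ∈ sites δ (ellipse ξ c (pos δ w) r) := by
  simp only [sites, ellipse, quad, mem_ofPred_eq, sub_self, zero_mul, mul_zero,
    Finset.sum_const_zero, neg_zero]
  positivity

/-- `ε_i = ε₀ - δ i`. -/
def epsI (ε₀ δ : ℝ) (i : ℕ) : ℝ := ε₀ - δ * i

/-- `r_i = √(δ^{1-η} / ε_i)`. -/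
def rI (η ε₀ δ : ℝ) (i : ℕ) : ℝ := Real.sqrt (δ ^ (1 - η) / epsI ε₀ δ i)

/-- `t_0 = δ^{-2-η}` and `t_{i+1} - t_i = (r_i / δ)² δ^{-5η}`. -/
def tI (η ε₀ δ : ℝ) : ℕ → ℝ
  | 0 => δ ^ (-2 - η)
  | i + 1 => tI η ε₀ δ i + (rI η ε₀ δ i / δ) ^ 2 * δ ^ (-5 * η)

/-- The integer part of `(ε₀ - δ^{1-4η}) / δ`. -/
def iMax (η ε₀ δ : ℝ) : ℤ := ⌊(ε₀ - δ ^ (1 - 4 * η)) / δ⌋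

/-- The boundary datum `f_{i,w}(x) = φ(x) + ε_i (C_{i,w} + ⟨∇ψ(w), x - w⟩)`, where
`C_{i,w} = ψ(w) - r_i²/2`. -/
def bdryDatum (φ : Plane → ℝ) (ξ c ε r : ℝ) (w x : Plane) : ℝ :=
  φ x + ε * (psi ξ c w - r ^ 2 / 2 + ∑ j : Fin 2, pd j (psi ξ c) w * (x j - w j))

end Lozenge

end

open Lozenge

namespace Lozenge

/-! ### Height functions and single updates -/

/-! Both dynamics are run with the same clocks and coins, and the one in `W` is shown to stay below
the one in the half-size ellipse at every common vertex. Whenever the latter is below the level at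
`w`, so is the former. The ellipse may stick out of `W`, so neither domain contains the other and
the order must be maintained at three kinds of common vertices.

On the boundary of the ellipse, the ellipse dynamics is frozen at its starting point. Since `φ + ε_i
ψ` has slopes in the Newton polygon, its rounding down is a height function, so the starting point
is the largest multiple of `δ` below the common ceiling at every site. Nothing under that ceiling
can exceed it, and the order also holds at time zero.

On the boundary of `W`, the dynamics in `W` is frozen near `φ`, at most `φ + Kδ`, and the floor
`φ_{i,w} - δ^{1-2η}` of the ellipse dynamics lies above that. At vertices interior to both domains,
heat-bath updates are monotone. Censoring preserves this because the ceilings agree, the floors are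
ordered, and the possible values at a vertex differ by at most one (`censoredUpdate_mono`,
`glauber_le_glauber`).

What remains is analytic (`limitShape_bounds`): `φ + ε/2 ≤ φ_{i,w} ≤ φ + εψ + O(ε r²)` in the
ellipse, with `ε = ε_i` and `r = r_i`. The lower bound orders the floors and handles the boundary of
`W`; the upper bound puts the floor below the starting point. By the maximum principle
(`quad_barrier`), `φ_{i,w}` differs from its boundary datum by at most `ε M (r² - Q_w)`. Replacing
`φ` by the datum plus or minus this bump moves the slope by `O(ε)`, hence changes the coefficients
in the equation by `O(ε)`, while the bump contributes a term of order `ε M` with a sign. A large `M`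
wins. The scales satisfy `ε r² = δ^{1-η} ≪ δ^{1-2η} ≪ δ^{1-4η} ≤ ε`, which absorbs all errors
(`exists_scale`). -/

theorem Nbr.of_e₁ {x y : Vertex} (h : x - y = e₁) : Nbr x y ∧ Nbr y x := by simp [Nbr, h]
theorem Nbr.of_e₂ {x y : Vertex} (h : x - y = e₂) : Nbr x y ∧ Nbr y x := by simp [Nbr, h]
theorem Nbr.of_e₃ {x y : Vertex} (h : x - y = e₃) : Nbr x y ∧ Nbr y x := by simp [Nbr, h]

theorem mem_of_nbr {A : Set Vertex} {x y : Vertex} (hx : x ∈ A \ bdry A) (h : Nbr x y) : y ∈ A := by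
  by_contra hy
  exact hx.2 ⟨hx.1, y, h, hy⟩

/-- Equivalent formulation of admissibility with inequalities. -/
theorem isHeight_iff {A : Set Vertex} {h : A → ℤ} :
    IsHeight A h ↔ ∀ x y : A,
      ((x : Vertex) - y = e₁ → h x ≤ h y ∧ h y ≤ h x + 1) ∧
      ((x : Vertex) - y = e₂ → h x ≤ h y ∧ h y ≤ h x + 1) ∧
      ((x : Vertex) - y = e₃ → h y ≤ h x ∧ h x ≤ h y + 1) := by
  have h1 (a b : ℤ) : a - b ∈ ({-1, 0} : Set ℤ) ↔ a ≤ b ∧ b ≤ a + 1 := by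
    simp only [mem_insert_iff, mem_singleton_iff]; omega
  have h2 (a b : ℤ) : a - b ∈ ({0, 1} : Set ℤ) ↔ b ≤ a ∧ a ≤ b + 1 := by
    simp only [mem_insert_iff, mem_singleton_iff]; omega
  simp only [IsHeight, h1, h2]
  exact forall₂_congr fun x y => by tauto

theorem IsHeight.min {A : Set Vertex} {h k : A → ℤ} (hh : IsHeight A h) (hk : IsHeight A k) :
    IsHeight A fun x => min (h x) (k x) := by
  rw [isHeight_iff] at *
  intro x y
  obtain ⟨a1, a2, a3⟩ := hh x y
  obtain ⟨b1, b2, b3⟩ := hk x y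
  refine ⟨fun e => ?_, fun e => ?_, fun e => ?_⟩
  · have := a1 e; have := b1 e; omega
  · have := a2 e; have := b2 e; omega
  · have := a3 e; have := b3 e; omega

/-- If there are height functions with boundary values `g` below `b`, then there is a greatest one. -/
theorem exists_isGreatest {A : Set Vertex} {g : Vertex → ℤ} {b : A → ℤ}
    (hne : {h | h ∈ Omega A g ∧ ∀ x, h x ≤ b x}.Nonempty) :
    ∃ h, IsGreatest {h | h ∈ Omega A g ∧ ∀ x, h x ≤ b x} h := by
  set S := {h | h ∈ Omega A g ∧ ∀ x, h x ≤ b x}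
  have hbdd (x : A) : BddAbove ((fun h : A → ℤ => h x) '' S) :=
    ⟨b x, by rintro _ ⟨h, hh, rfl⟩; exact hh.2 x⟩
  have hmem (x : A) : ∃ h ∈ S, h x = sSup ((fun h : A → ℤ => h x) '' S) :=
    Int.csSup_mem (hne.image _) (hbdd x)
  have hle (x : A) (h : A → ℤ) (hh : h ∈ S) : h x ≤ sSup ((fun h : A → ℤ => h x) '' S) :=
    le_csSup (hbdd x) ⟨h, hh, rfl⟩
  refine ⟨fun x => sSup ((fun h : A → ℤ => h x) '' S), ⟨⟨?_, fun x hx => ?_⟩, fun x => ?_⟩,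
    fun h hh x => hle x h hh⟩
  · rw [isHeight_iff]
    intro x y
    -- The suprema at `x` and `y` may be attained by different functions `h` and `k`. Each gradient
    -- bound follows from the bound for one of them together with `k x ≤ h x` and `h y ≤ k y`.
    obtain ⟨h, hh, hx⟩ := hmem x
    obtain ⟨k, hk, ky⟩ := hmem y
    have hx' := hle x k hk
    have hy' := hle y h hh
    have h3 := isHeight_iff.1 hh.1.1 x y
    have k3 := isHeight_iff.1 hk.1.1 x y
    simp only [← hx, ← ky] at hx' hy' ⊢
    refine ⟨fun e => ?_, fun e => ?_, fun e => ?_⟩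
    · have := h3.1 e; have := k3.1 e; omega
    · have := h3.2.1 e; have := k3.2.1 e; omega
    · have := h3.2.2 e; have := k3.2.2 e; omega
  · obtain ⟨h, hh, he⟩ := hmem x
    simp only
    rw [← he]
    exact hh.1.2 x hx
  · obtain ⟨h, hh, he⟩ := hmem x
    simp only
    rw [← he]
    exact hh.2 x

theorem setAt_self {A : Set Vertex} (h : A → ℤ) (x : A) : setAt h x (h x) = h := by
  funext y
  by_cases e : (y : Vertex) = x
  · simp [setAt, Subtype.ext e]
  · simp [setAt, e]

theorem setAt_same {A : Set Vertex} (h : A → ℤ) (x : A) (v : ℤ) : setAt h x v x = v := by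
  simp [setAt]

theorem setAt_of_ne {A : Set Vertex} (h : A → ℤ) {x : Vertex} {y : A} (v : ℤ)
    (e : (y : Vertex) ≠ x) : setAt h x v y = h y := by
  simp [setAt, e]

theorem mem_values_self {A : Set Vertex} {h : A → ℤ} (hh : IsHeight A h) (x : A) :
    h x ∈ values h x := by
  simpa [values, setAt_self] using hh

theorem e_ne_zero : (0 : Vertex) ≠ e₁ ∧ (0 : Vertex) ≠ e₂ ∧ (0 : Vertex) ≠ e₃ := by
  simp [e₁, e₂, e₃, Prod.ext_iff]

/-- Local description of the possible values at a vertex. -/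
theorem mem_values_iff {A : Set Vertex} {h : A → ℤ} (hh : IsHeight A h) (x : A) (v : ℤ) :
    v ∈ values h x ↔ ∀ y : A,
      ((x : Vertex) - y = e₁ ∨ (x : Vertex) - y = e₂ ∨ (y : Vertex) - x = e₃ →
        v ≤ h y ∧ h y ≤ v + 1) ∧
      ((y : Vertex) - x = e₁ ∨ (y : Vertex) - x = e₂ ∨ (x : Vertex) - y = e₃ →
        h y ≤ v ∧ v ≤ h y + 1) := by
  obtain ⟨z1, z2, z3⟩ := e_ne_zero
  change IsHeight A (setAt h x v) ↔ _
  constructor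
  · intro H y
    by_cases e : (y : Vertex) = x
    · simp [e, z1, z2, z3]
    · have a := isHeight_iff.1 H x y
      have b := isHeight_iff.1 H y x
      rw [setAt_same, setAt_of_ne h v e] at a b
      tauto
  · intro H
    rw [isHeight_iff]
    intro y z
    by_cases e : (y : Vertex) = x
    · obtain rfl := Subtype.ext e
      by_cases e' : (z : Vertex) = y
      · simp [e', z1, z2, z3]
      · rw [setAt_same, setAt_of_ne h v e']
        have := H z
        tauto
    · by_cases e' : (z : Vertex) = x
      · obtain rfl := Subtype.ext e'
        rw [setAt_same, setAt_of_ne h v e]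
        have := H y
        tauto
      · rw [setAt_of_ne h v e, setAt_of_ne h v e']
        exact isHeight_iff.1 hh y z

/-- The neighbour `x - e₁` confines every possible value to two consecutive integers. It belongs to
`A` because `x` is not a boundary vertex. -/
theorem values_dist_le {A : Set Vertex} {h : A → ℤ} (hh : IsHeight A h) {x : A}
    (hx : (x : Vertex) ∈ A \ bdry A) {v v' : ℤ} (hv : v ∈ values h x) (hv' : v' ∈ values h x) :
    v ≤ v' + 1 := by
  have hn : Nbr x (x - e₁) := (Nbr.of_e₁ (by abel)).1
  have h1 := ((mem_values_iff hh x v).1 hv ⟨_, mem_of_nbr hx hn⟩).1 (Or.inl (by simp))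
  have h2 := ((mem_values_iff hh x v').1 hv' ⟨_, mem_of_nbr hx hn⟩).1 (Or.inl (by simp))
  omega

theorem bddAbove_values {A : Set Vertex} {h : A → ℤ} (hh : IsHeight A h) {x : A}
    (hx : (x : Vertex) ∈ A \ bdry A) : BddAbove (values h x) :=
  ⟨h x + 1, fun _ hv => values_dist_le hh hx hv (mem_values_self hh x)⟩

theorem bddBelow_values {A : Set Vertex} {h : A → ℤ} (hh : IsHeight A h) {x : A}
    (hx : (x : Vertex) ∈ A \ bdry A) : BddBelow (values h x) :=
  ⟨h x - 1, fun _ hv => by have := values_dist_le hh hx (mem_values_self hh x) hv; omega⟩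

theorem resample_mem {A : Set Vertex} {h : A → ℤ} (hh : IsHeight A h) {x : A}
    (hx : (x : Vertex) ∈ A \ bdry A) (b : Bool) : resample h x b ∈ values h x := by
  have hne : (values h x).Nonempty := ⟨_, mem_values_self hh x⟩
  cases b
  · exact Int.csInf_mem hne (bddBelow_values hh hx)
  · exact Int.csSup_mem hne (bddAbove_values hh hx)

theorem le_resample_true {A : Set Vertex} {h : A → ℤ} (hh : IsHeight A h) {x : A}
    (hx : (x : Vertex) ∈ A \ bdry A) {v : ℤ} (hv : v ∈ values h x) : v ≤ resample h x true :=
  le_csSup (bddAbove_values hh hx) hv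

theorem resample_false_le {A : Set Vertex} {h : A → ℤ} (hh : IsHeight A h) {x : A}
    (hx : (x : Vertex) ∈ A \ bdry A) {v : ℤ} (hv : v ∈ values h x) : resample h x false ≤ v :=
  csInf_le (bddBelow_values hh hx) hv

/-- Minima and maxima of possible values for ordered height functions are possible values. -/
theorem min_max_mem_values {A B : Set Vertex} {h : A → ℤ} {k : B → ℤ} (hh : IsHeight A h)
    (hk : IsHeight B k) (hle : ∀ x (ha : x ∈ A) (hb : x ∈ B), h ⟨x, ha⟩ ≤ k ⟨x, hb⟩) {x : Vertex}
    (hA : x ∈ A \ bdry A) (hB : x ∈ B \ bdry B) {v v' : ℤ} (hv : v ∈ values h x)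
    (hv' : v' ∈ values k x) : min v v' ∈ values h x ∧ max v v' ∈ values k x := by
  have Hv := (mem_values_iff hh ⟨x, hA.1⟩ v).1 hv
  have Hv' := (mem_values_iff hk ⟨x, hB.1⟩ v').1 hv'
  have nb {y : Vertex} (e : (x - y = e₁ ∨ x - y = e₂ ∨ y - x = e₃) ∨
      (y - x = e₁ ∨ y - x = e₂ ∨ x - y = e₃)) : Nbr x y := by
    rcases e with (e | e | e) | (e | e | e)
    exacts [(Nbr.of_e₁ e).1, (Nbr.of_e₂ e).1, (Nbr.of_e₃ e).2, (Nbr.of_e₁ e).2, (Nbr.of_e₂ e).2,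
      (Nbr.of_e₃ e).1]
  -- Possible values form an integer interval whose endpoints are monotone in the neighbouring
  -- heights. All neighbours of `x` lie in both domains, so these endpoints can be compared.
  constructor
  · refine (mem_values_iff hh ⟨x, hA.1⟩ _).2 fun y => ⟨fun e => ?_, fun e => ?_⟩
    · have hyB := mem_of_nbr hB (nb (.inl e))
      have := (Hv y).1 e
      have := (Hv' ⟨y, hyB⟩).1 e
      have := hle y y.2 hyB
      simp only [Subtype.coe_eta] at *
      omega
    · have hyB := mem_of_nbr hB (nb (.inr e))
      have := (Hv y).2 e
      have := (Hv' ⟨y, hyB⟩).2 e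
      have := hle y y.2 hyB
      simp only [Subtype.coe_eta] at *
      omega
  · refine (mem_values_iff hk ⟨x, hB.1⟩ _).2 fun y => ⟨fun e => ?_, fun e => ?_⟩
    · have hyA := mem_of_nbr hA (nb (.inl e))
      have := (Hv' y).1 e
      have := (Hv ⟨y, hyA⟩).1 e
      have := hle y hyA y.2
      simp only [Subtype.coe_eta] at *
      omega
    · have hyA := mem_of_nbr hA (nb (.inr e))
      have := (Hv' y).2 e
      have := (Hv ⟨y, hyA⟩).2 e
      have := hle y hyA y.2
      simp only [Subtype.coe_eta] at *
      omega

theorem resample_mono {A B : Set Vertex} {h : A → ℤ} {k : B → ℤ} (hh : IsHeight A h)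
    (hk : IsHeight B k) (hle : ∀ x (ha : x ∈ A) (hb : x ∈ B), h ⟨x, ha⟩ ≤ k ⟨x, hb⟩) {x : Vertex}
    (hA : x ∈ A \ bdry A) (hB : x ∈ B \ bdry B) (b : Bool) : resample h x b ≤ resample k x b := by
  have H := min_max_mem_values hh hk hle hA hB (resample_mem (x := ⟨x, hA.1⟩) hh hA b)
    (resample_mem (x := ⟨x, hB.1⟩) hk hB b)
  cases b
  · have := resample_false_le (x := ⟨x, hA.1⟩) hh hA H.1
    simp only at this
    omega
  · have := le_resample_true (x := ⟨x, hB.1⟩) hk hB H.2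
    simp only at this
    omega

/-- The properties of a height function that the constrained dynamics preserves. -/
structure Confined (δ : ℝ) (A : Set Vertex) (up : Plane → ℝ) (g h : A → ℤ) : Prop where
  isHeight : IsHeight A h
  bdry_eq : ∀ x : A, (x : Vertex) ∈ bdry A → h x = g x
  le_up : ∀ x : A, δ * h x ≤ up (pos δ x)

theorem censoredUpdate_apply_of_ne {δ : ℝ} {A : Set Vertex} {lo up : Plane → ℝ} {h : A → ℤ}
    {x : Vertex} {b : Bool} {y : A} (e : (y : Vertex) ≠ x) :
    censoredUpdate δ lo up h x b y = h y := by
  unfold censoredUpdate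
  split_ifs
  · exact setAt_of_ne h _ e
  · rfl

theorem censoredUpdate_of_accepted {δ : ℝ} {A : Set Vertex} {lo up : Plane → ℝ} {h : A → ℤ}
    {x : Vertex} {b : Bool}
    (hc : lo (pos δ x) ≤ δ * resample h x b ∧ δ * resample h x b ≤ up (pos δ x)) :
    censoredUpdate δ lo up h x b = setAt h x (resample h x b) := by
  simp only [censoredUpdate, if_pos hc]

theorem censoredUpdate_of_discarded {δ : ℝ} {A : Set Vertex} {lo up : Plane → ℝ} {h : A → ℤ}
    {x : Vertex} {b : Bool}
    (hc : ¬(lo (pos δ x) ≤ δ * resample h x b ∧ δ * resample h x b ≤ up (pos δ x))) :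
    censoredUpdate δ lo up h x b = h := by
  simp only [censoredUpdate, if_neg hc]

theorem Confined.censoredUpdate {δ : ℝ} {A : Set Vertex} {lo up : Plane → ℝ} {g h : A → ℤ}
    (H : Confined δ A up g h) {x : Vertex} (hx : x ∈ A \ bdry A) (b : Bool) :
    Confined δ A up g (censoredUpdate δ lo up h x b) := by
  by_cases hc : lo (pos δ x) ≤ δ * resample h x b ∧ δ * resample h x b ≤ up (pos δ x)
  swap
  · rwa [censoredUpdate_of_discarded hc]
  rw [censoredUpdate_of_accepted hc]
  refine ⟨resample_mem (x := ⟨x, hx.1⟩) H.isHeight hx b, fun y hy => ?_, fun y => ?_⟩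
  · rw [setAt_of_ne h _ (by rintro rfl; exact hx.2 hy)]
    exact H.bdry_eq y hy
  · by_cases e : (y : Vertex) = x
    · obtain rfl := e
      rw [setAt_same]
      exact hc.2
    · rw [setAt_of_ne h _ e]
      exact H.le_up y

/-- Kept apart from `Confined` because only the ellipse dynamics is required to stay above its
floor; the comparison never uses this for the dynamics in `W`. -/
theorem lo_le_censoredUpdate {δ : ℝ} {A : Set Vertex} {lo up : Plane → ℝ} {h : A → ℤ}
    (H : ∀ y : A, lo (pos δ y) ≤ δ * h y) (x : Vertex) (b : Bool) (y : A) :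
    lo (pos δ y) ≤ δ * censoredUpdate δ lo up h x b y := by
  by_cases hc : lo (pos δ x) ≤ δ * resample h x b ∧ δ * resample h x b ≤ up (pos δ x)
  swap
  · rw [censoredUpdate_of_discarded hc]
    exact H y
  rw [censoredUpdate_of_accepted hc]
  by_cases e : (y : Vertex) = x
  · obtain rfl := e
    rw [setAt_same]
    exact hc.1
  · rw [setAt_of_ne h _ e]
    exact H y

/-- Monotonicity of the constrained update at a vertex interior to both domains. -/
theorem censoredUpdate_mono {δ : ℝ} (hδ : 0 < δ) {A B : Set Vertex} {loA loB up : Plane → ℝ}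
    {gA h : A → ℤ} {gB k : B → ℤ} {x : Vertex} (hh : Confined δ A up gA h)
    (hk : Confined δ B up gB k) (hklo : ∀ y : B, loB (pos δ y) ≤ δ * k y)
    (hle : ∀ x (ha : x ∈ A) (hb : x ∈ B), h ⟨x, ha⟩ ≤ k ⟨x, hb⟩)
    (hA : x ∈ A \ bdry A) (hB : x ∈ B \ bdry B) (hlo : loA (pos δ x) ≤ loB (pos δ x)) (b : Bool) :
    censoredUpdate δ loA up h x b ⟨x, hA.1⟩ ≤ censoredUpdate δ loB up k x b ⟨x, hB.1⟩ := by
  have hr := resample_mono hh.isHeight hk.isHeight hle hA hB b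
  have hx := hle x hA.1 hB.1
  have lt_of {m n : ℤ} (hmn : δ * (m : ℝ) < δ * n) : m < n := by
    exact_mod_cast lt_of_mul_lt_mul_left hmn hδ.le
  have mul_mono {m n : ℤ} (hmn : m ≤ n) : δ * (m : ℝ) ≤ δ * n :=
    mul_le_mul_of_nonneg_left (by exact_mod_cast hmn) hδ.le
  have hself := mem_values_self hh.isHeight ⟨x, hA.1⟩
  have kself := mem_values_self hk.isHeight ⟨x, hB.1⟩
  have hmem := resample_mem (x := ⟨x, hA.1⟩) hh.isHeight hA b
  have kmem := resample_mem (x := ⟨x, hB.1⟩) hk.isHeight hB b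
  have hup := hh.le_up ⟨x, hA.1⟩
  have kup := hk.le_up ⟨x, hB.1⟩
  have klo := hklo ⟨x, hB.1⟩
  have hd := values_dist_le (x := ⟨x, hA.1⟩) hh.isHeight hA hself hmem
  have kd := values_dist_le (x := ⟨x, hB.1⟩) hk.isHeight hB kmem kself
  unfold censoredUpdate
  simp only at *
  have sA (v : ℤ) : setAt h x v ⟨x, hA.1⟩ = v := setAt_same h ⟨x, hA.1⟩ v
  have sB (v : ℤ) : setAt k x v ⟨x, hB.1⟩ = v := setAt_same k ⟨x, hB.1⟩ v
  split_ifs with h1 h2 h2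
  · rwa [sA, sB]
  -- Only the upper update is discarded. If it fell below the floor, it was a downward move from `k
  -- x`. If it exceeded the ceiling, it was an upward move by one, and the accepted lower value is
  -- strictly smaller than it.
  · rw [sA]
    rw [not_and_or, not_le, not_le] at h2
    rcases h2 with h2 | h2
    · have := lt_of (h2.trans_le klo)
      omega
    · have := lt_of (h1.2.trans_lt h2)
      have := lt_of (kup.trans_lt h2)
      omega
  -- Only the lower update is discarded. If it fell below `loA`, it is strictly below the accepted
  -- upper value, and `h x` exceeds it by at most one. It cannot exceed the ceiling, which is common
  -- to both dynamics.
  · rw [sB]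
    rw [not_and_or, not_le, not_le] at h1
    rcases h1 with h1 | h1
    · have := lt_of (h1.trans_le (hlo.trans h2.1))
      omega
    · have := mul_mono hr
      linarith [h2.2]
  · exact hx

/-! ### Comparison of the dynamics in two domains driven by the same clocks -/

/-- Allows both dynamics to be written as folds over one common list of rings, each skipping those
outside its own interior, so that a single induction compares them. -/
theorem sort_eq_filter_sort {α : Type*} [LinearOrder α] {S T : Finset α} (p : α → Prop)
    [DecidablePred p] (h : ∀ r, r ∈ S ↔ r ∈ T ∧ p r) : S.sort = T.sort.filter (fun r => p r) := by
  have hp : S.sort.Perm (T.sort.filter (fun r => p r)) := by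
    rw [List.perm_ext_iff_of_nodup (Finset.sort_nodup _ _) ((Finset.sort_nodup _ _).filter _)]
    intro r
    simp [h r]
  exact hp.eq_of_pairwise' (Finset.pairwise_sort _ _) ((Finset.pairwise_sort _ _).filter _)

theorem ringVertex_mkRing (s : ℝ) (x : Vertex) (n : ℕ) : ringVertex (mkRing s x n) = x := rfl

theorem mem_rings_iff_of_mem {A B : Set Vertex} {ζ : Clocks} {t : ℝ} {r : ClockRing}
    (hr : r ∈ rings B ζ t) : r ∈ rings A ζ t ↔ ringVertex r ∈ A \ bdry A := by
  obtain ⟨x, -, n, hn, rfl⟩ := hr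
  rw [ringVertex_mkRing]
  constructor
  · rintro ⟨y, hy, m, -, e⟩
    have : x = y := by simpa only [ringVertex_mkRing] using congrArg ringVertex e
    rwa [this]
  · exact fun hx => ⟨x, hx, n, hn, rfl⟩

open Classical in
/-- The dynamics as a fold over any finite set of rings that contains those of the domain. -/
theorem glauber_eq_foldl {δ : ℝ} {A : Set Vertex} {lo up : Plane → ℝ} {h₀ : A → ℤ} {ζ : Clocks}
    {t : ℝ} (T : Finset ClockRing) (hsub : rings A ζ t ⊆ T)
    (hT : ∀ r ∈ T, ∃ B, r ∈ rings B ζ t) :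
    glauber δ A lo up h₀ ζ t = T.sort.foldl
      (fun h r => if ringVertex r ∈ A \ bdry A then
        censoredUpdate δ lo up h (ringVertex r) (ζ (ringVertex r, ringIndex r)).2 else h) h₀ := by
  have hfin : (rings A ζ t).Finite := T.finite_toSet.subset hsub
  rw [glauber, dif_pos hfin, sort_eq_filter_sort (T := T) (fun r => ringVertex r ∈ A \ bdry A),
    List.foldl_filter]
  · simp
  · intro r
    rw [Set.Finite.mem_toFinset]
    constructor
    · intro h
      exact ⟨hsub h, (mem_rings_iff_of_mem h).1 h⟩
    · rintro ⟨h1, h2⟩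
      obtain ⟨B, hB⟩ := hT r h1
      exact (mem_rings_iff_of_mem hB).2 h2

/-- Comparison of the constrained dynamics in two domains, driven by the same clocks. -/
theorem glauber_le_glauber {δ : ℝ} (hδ : 0 < δ) {A B : Set Vertex} {loA loB up : Plane → ℝ}
    {h₀ : A → ℤ} {k₀ : B → ℤ} (hh : Confined δ A up h₀ h₀) (hk : Confined δ B up k₀ k₀)
    (hklo : ∀ y : B, loB (pos δ y) ≤ δ * k₀ y)
    (hlo : ∀ x ∈ A, x ∈ B → loA (pos δ x) ≤ loB (pos δ x))
    (hbA : ∀ x : A, (x : Vertex) ∈ bdry A → (x : Vertex) ∈ B → δ * h₀ x ≤ loB (pos δ x))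
    (hmax : ∀ x : B, ∀ v : ℤ, δ * v ≤ up (pos δ x) → v ≤ k₀ x)
    {ζ : Clocks} {t : ℝ} (hA : (rings A ζ t).Finite) (hB : (rings B ζ t).Finite)
    (x : Vertex) (ha : x ∈ A) (hb : x ∈ B) :
    glauber δ A loA up h₀ ζ t ⟨x, ha⟩ ≤ glauber δ B loB up k₀ ζ t ⟨x, hb⟩ := by
  classical
  have hT : ∀ r ∈ (hA.toFinset ∪ hB.toFinset), ∃ B, r ∈ rings B ζ t := by
    intro r hr
    rw [Finset.mem_union, Set.Finite.mem_toFinset, Set.Finite.mem_toFinset] at hr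
    exact hr.elim (fun h => ⟨_, h⟩) fun h => ⟨_, h⟩
  rw [glauber_eq_foldl (hA.toFinset ∪ hB.toFinset) (by simp) hT,
    glauber_eq_foldl (hA.toFinset ∪ hB.toFinset) (by simp) hT]
  generalize (hA.toFinset ∪ hB.toFinset).sort = l
  suffices ∀ (h : A → ℤ) (k : B → ℤ), Confined δ A up h₀ h → Confined δ B up k₀ k →
      (∀ y : B, loB (pos δ y) ≤ δ * k y) →
      (∀ x (ha : x ∈ A) (hb : x ∈ B), h ⟨x, ha⟩ ≤ k ⟨x, hb⟩) →
      l.foldl (fun h r => if ringVertex r ∈ A \ bdry A then censoredUpdate δ loA up h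
          (ringVertex r) (ζ (ringVertex r, ringIndex r)).2 else h) h ⟨x, ha⟩ ≤
        l.foldl (fun h r => if ringVertex r ∈ B \ bdry B then censoredUpdate δ loB up h
          (ringVertex r) (ζ (ringVertex r, ringIndex r)).2 else h) k ⟨x, hb⟩ from
    this h₀ k₀ hh hk hklo fun x ha hb => hmax ⟨x, hb⟩ _ (hh.le_up ⟨x, ha⟩)
  induction l with
  | nil => exact fun h k _ _ _ hle => hle x ha hb
  | cons r l ih =>
    intro h k ch ck hk' hle
    rw [List.foldl_cons, List.foldl_cons]
    generalize (ζ (ringVertex r, ringIndex r)).2 = b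
    generalize ringVertex r = z
    have le_of {m n : ℤ} (hmn : δ * (m : ℝ) ≤ δ * n) : m ≤ n := by
      exact_mod_cast le_of_mul_le_mul_left hmn hδ
    -- Only the updated vertex `z` matters. On the boundary of `A` the frozen height is below the
    -- floor of `k'`; on the boundary of `B` the frozen height of `k'` is maximal under the ceiling;
    -- the remaining case is left to `hz`.
    have key (h' : A → ℤ) (k' : B → ℤ) (ch' : Confined δ A up h₀ h') (ck' : Confined δ B up k₀ k')
        (hk'' : ∀ y : B, loB (pos δ y) ≤ δ * k' y)
        (hne : ∀ y : A, (y : Vertex) ≠ z → h' y = h y)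
        (kne : ∀ y : B, (y : Vertex) ≠ z → k' y = k y)
        (hz : ∀ (ha : z ∈ A) (hb : z ∈ B), z ∈ A \ bdry A → z ∈ B \ bdry B →
          h' ⟨z, ha⟩ ≤ k' ⟨z, hb⟩) :
        ∀ x (ha : x ∈ A) (hb : x ∈ B), h' ⟨x, ha⟩ ≤ k' ⟨x, hb⟩ := by
      intro y ya yb
      by_cases e : y = z
      · subst e
        by_cases h1 : y ∈ bdry A
        · rw [ch'.bdry_eq ⟨y, ya⟩ h1]
          exact le_of ((hbA ⟨y, ya⟩ h1 yb).trans (hk'' ⟨y, yb⟩))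
        by_cases h2 : y ∈ bdry B
        · rw [ck'.bdry_eq ⟨y, yb⟩ h2]
          exact hmax ⟨y, yb⟩ _ (ch'.le_up ⟨y, ya⟩)
        exact hz ya yb ⟨ya, h1⟩ ⟨yb, h2⟩
      · rw [hne ⟨y, ya⟩ e, kne ⟨y, yb⟩ e]
        exact hle y ya yb
    have ne (y : A) (e : (y : Vertex) ≠ z) : (censoredUpdate δ loA up h z b) y = h y :=
      censoredUpdate_apply_of_ne e
    have ne' (y : B) (e : (y : Vertex) ≠ z) : (censoredUpdate δ loB up k z b) y = k y :=
      censoredUpdate_apply_of_ne e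
    split_ifs with h1 h2 h2
    · exact ih _ _ (ch.censoredUpdate h1 b) (ck.censoredUpdate h2 b)
        (lo_le_censoredUpdate hk' z b) (key _ _ (ch.censoredUpdate h1 b) (ck.censoredUpdate h2 b)
        (lo_le_censoredUpdate hk' z b) ne ne'
        fun _ _ _ _ => censoredUpdate_mono hδ ch ck hk' hle h1 h2 (hlo z h1.1 h2.1) b)
    · exact ih _ _ (ch.censoredUpdate h1 b) ck hk' (key _ _ (ch.censoredUpdate h1 b) ck
        hk' ne (fun _ _ => rfl) fun _ _ _ h => absurd h h2)
    · exact ih _ _ ch (ck.censoredUpdate h2 b) (lo_le_censoredUpdate hk' z b)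
        (key _ _ ch (ck.censoredUpdate h2 b) (lo_le_censoredUpdate hk' z b) (fun _ _ => rfl) ne'
        fun _ _ h => absurd h h1)
    · exact ih _ _ ch ck hk' hle

/-! ### Almost surely, finitely many rings in finite time -/

theorem expMeasure_Iio_zero : expMeasure 1 (Iio 0) = 0 := by
  have h : cdf (expMeasure 1) 0 = 0 := by simp [cdf_expMeasure_eq one_pos]
  rw [cdf_eq_real, measureReal_eq_zero_iff] at h
  exact measure_mono_null Iio_subset_Iic_self h

theorem expMeasure_Ioi_one_ne_zero : expMeasure 1 (Ioi 1) ≠ 0 := by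
  intro h
  have h1 : cdf (expMeasure 1) 1 = 1 := by
    rw [cdf_eq_real, ← compl_Ioi, probReal_compl_eq_one_sub measurableSet_Ioi, measureReal_def, h]
    simp
  rw [cdf_expMeasure_eq one_pos] at h1
  have := Real.exp_pos (-(1 * 1))
  simp only [zero_le_one, if_true] at h1
  linarith

instance : IsProbabilityMeasure clockLaw := by unfold clockLaw; infer_instance

theorem clockLaw_wait (p : Vertex × ℕ) {s : Set ℝ} (hs : MeasurableSet s) :
    clockLaw {ζ | (ζ p).1 ∈ s} = expMeasure 1 s := by
  have h1 := (measurePreserving_eval_infinitePi (fun _ : Vertex × ℕ =>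
    (expMeasure 1).prod (PMF.uniformOfFintype Bool).toMeasure) p).measure_preimage
      (measurable_fst hs).nullMeasurableSet
  have h2 := (measurePreserving_fst (μ := expMeasure 1)
    (ν := (PMF.uniformOfFintype Bool).toMeasure)).measure_preimage hs.nullMeasurableSet
  exact h1.trans h2

theorem ae_wait_nonneg (p : Vertex × ℕ) : ∀ᵐ ζ ∂clockLaw, 0 ≤ (ζ p).1 := by
  have : clockLaw {ζ | (ζ p).1 ∈ Iio 0} = 0 :=
    (clockLaw_wait p measurableSet_Iio).trans expMeasure_Iio_zero
  rw [ae_iff]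
  simpa using this

/-- Second Borel-Cantelli lemma: the events are independent with the same positive probability. -/
theorem ae_frequently_one_lt_wait (x : Vertex) :
    ∀ᵐ ζ ∂clockLaw, ∃ᶠ n in Filter.atTop, 1 < (ζ (x, n)).1 := by
  set s : ℕ → Set Clocks := fun n => {ζ | (ζ (x, n)).1 ∈ Ioi 1}
  have hmeas (p : Vertex × ℕ) : Measurable fun ζ : Clocks => (ζ p).1 := by fun_prop
  have hsm (n : ℕ) : MeasurableSet (s n) := hmeas (x, n) measurableSet_Ioi
  have hind : iIndepSet s clockLaw := by
    have h0 : iIndepFun (fun (p : Vertex × ℕ) (ζ : Clocks) => (ζ p).1) clockLaw :=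
      iIndepFun_infinitePi (X := fun _ (c : ℝ × Bool) => c.1) (fun _ => measurable_fst)
    have h1 : iIndepFun (fun (n : ℕ) (ζ : Clocks) => (ζ (x, n)).1) clockLaw :=
      h0.precomp (g := fun n : ℕ => (x, n)) (fun a b h => by simpa using h)
    rw [iIndepSet_iff_meas_biInter hsm]
    intro S
    exact h1.meas_biInter fun i _ => ⟨Ioi 1, measurableSet_Ioi, rfl⟩
  have hsum : ∑' n, clockLaw (s n) = ⊤ := by
    simp only [s, clockLaw_wait _ measurableSet_Ioi]
    exact ENNReal.tsum_const_eq_top_of_ne_zero expMeasure_Ioi_one_ne_zero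
  have h := measure_limsup_eq_one hsm hind hsum
  have hae := (mem_ae_iff_prob_eq_one (MeasurableSet.measurableSet_limsup hsm)).2 h
  filter_upwards [hae] with ζ hζ
  exact Filter.mem_limsup_iff_frequently_mem.1 hζ

theorem tendsto_sum_atTop {a : ℕ → ℝ} (h0 : ∀ n, 0 ≤ a n) (h1 : ∃ᶠ n in Filter.atTop, 1 < a n) :
    Filter.Tendsto (fun n => ∑ k ∈ Finset.range (n + 1), a k) Filter.atTop Filter.atTop := by
  have hnot : ¬ Summable a := by
    intro hs
    have := hs.tendsto_atTop_zero.eventually_lt_const one_pos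
    obtain ⟨n, h, h'⟩ := (h1.and_eventually this).exists
    linarith
  exact ((not_summable_iff_tendsto_nat_atTop_of_nonneg h0).1 hnot).comp
    (Filter.tendsto_add_atTop_nat 1)

/-- Excludes the default branch of `glauber`, which returns the initial state when the rings are
infinite in number. The null set is the same for all times. -/
theorem ae_finite_rings {A : Set Vertex} (hA : A.Finite) :
    ∀ᵐ ζ ∂clockLaw, ∀ t, (rings A ζ t).Finite := by
  have h0 : ∀ᵐ ζ ∂clockLaw, ∀ p, 0 ≤ (ζ p).1 := ae_all_iff.2 ae_wait_nonneg
  have h1 := ae_all_iff.2 ae_frequently_one_lt_wait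
  filter_upwards [h0, h1] with ζ h0 h1 t
  have hfin (x : Vertex) : {n | ringTime ζ x n ≤ t}.Finite := by
    have := (tendsto_sum_atTop (fun n => h0 (x, n)) (h1 x)).eventually_gt_atTop t
    obtain ⟨N, hN⟩ := Filter.eventually_atTop.1 this
    refine (finite_lt_nat N).subset fun n hn => ?_
    by_contra hc
    exact absurd (hN n (not_lt.1 hc)) (not_lt.2 hn)
  have : rings A ζ t ⊆ ⋃ x ∈ A, (fun n => mkRing (ringTime ζ x n) x n) '' {n | ringTime ζ x n ≤ t} := by
    rintro r ⟨x, hx, n, hn, rfl⟩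
    exact mem_biUnion hx.1 ⟨n, hn, rfl⟩
  exact (hA.biUnion fun x _ => (hfin x).image _).subset this

/-- Comparison of the probabilities to stay below a level. -/
theorem probBelow_le_probBelow {δ : ℝ} (hδ : 0 < δ) {A B : Set Vertex} (hA : A.Finite)
    (hB : B.Finite) {loA loB up : Plane → ℝ}
    {h₀ : A → ℤ} {k₀ : B → ℤ} (hh : Confined δ A up h₀ h₀) (hk : Confined δ B up k₀ k₀)
    (hklo : ∀ y : B, loB (pos δ y) ≤ δ * k₀ y)
    (hlo : ∀ x ∈ A, x ∈ B → loA (pos δ x) ≤ loB (pos δ x))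
    (hbA : ∀ x : A, (x : Vertex) ∈ bdry A → (x : Vertex) ∈ B → δ * h₀ x ≤ loB (pos δ x))
    (hmax : ∀ x : B, ∀ v : ℤ, δ * v ≤ up (pos δ x) → v ≤ k₀ x)
    (w : Vertex) (ha : w ∈ A) (hb : w ∈ B) (b : ℝ) (I : Set ℝ) :
    probBelow δ B loB up k₀ ⟨w, hb⟩ b I ≤ probBelow δ A loA up h₀ ⟨w, ha⟩ b I := by
  -- Almost sure inclusion of the events suffices, with no measurability of either event required.
  refine measure_mono_ae ?_
  filter_upwards [ae_finite_rings hA, ae_finite_rings hB] with ζ fA fB hζ t ht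
  have h1 := glauber_le_glauber hδ hh hk hklo hlo hbA hmax (fA t) (fB t) w ha hb
  exact (mul_le_mul_of_nonneg_left (by exact_mod_cast h1) hδ.le).trans_lt (hζ t ht)

/-! ### Partial derivatives -/

theorem pd_of_hasFDerivAt {f : Plane → ℝ} {f' : Plane →L[ℝ] ℝ} {x : Plane}
    (h : HasFDerivAt f f' x) (j : Fin 2) : pd j f x = f' (EuclideanSpace.single j 1) := by
  rw [pd, h.fderiv]

theorem pd_congr {f g : Plane → ℝ} {x : Plane} (h : f =ᶠ[nhds x] g) (j : Fin 2) :
    pd j f x = pd j g x := by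
  rw [pd, pd, h.fderiv_eq]

/-- The coordinate functionals. -/
noncomputable def coord (j : Fin 2) : Plane →L[ℝ] ℝ := EuclideanSpace.proj j

theorem coord_apply (j : Fin 2) (x : Plane) : coord j x = x j := rfl

theorem hasFDerivAt_coord (j : Fin 2) (x : Plane) : HasFDerivAt (fun y : Plane => y j) (coord j) x :=
  (coord j).hasFDerivAt

/-! ### The Newton polygon -/

theorem newton_subset : newton ⊆ {p | p 0 ≤ 0 ∧ p 1 ≤ 0 ∧ -1 ≤ p 0 + p 1} := by
  refine convexHull_min ?_ ?_
  · rintro p (rfl | rfl | rfl) <;> simp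
  · have h (j : Fin 2) : Convex ℝ {p : Plane | p j ≤ 0} :=
      convex_halfSpace_le (f := fun p : Plane => p j) (coord j).isLinear 0
    have h' : Convex ℝ {p : Plane | -1 ≤ p 0 + p 1} :=
      convex_halfSpace_ge (f := fun p : Plane => p 0 + p 1) (coord 0 + coord 1).isLinear (-1)
    exact (h 0).inter ((h 1).inter h')

/-- A ball is connected, so if it misses the frontier it cannot leave the interior. -/
theorem ball_subset_of_le_infDist_frontier {s : Set Plane} {p : Plane} {a : ℝ} (hp : p ∈ interior s)
    (h : a ≤ Metric.infDist p (frontier s)) : Metric.ball p a ⊆ s := by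
  rcases le_or_gt a 0 with ha | ha
  · simp [Metric.ball_eq_empty.2 ha]
  have hdisj : Disjoint (Metric.ball p a) (frontier s) :=
    (Metric.disjoint_ball_infDist).mono_left (Metric.ball_subset_ball h)
  have hsub : Metric.ball p a ⊆ interior s ∪ (closure s)ᶜ := by
    intro y hy
    by_contra hc
    rw [mem_union, not_or, notMem_compl_iff] at hc
    exact hdisj.ne_of_mem hy ⟨hc.2, hc.1⟩ rfl
  have hsep : Disjoint (interior s) (closure s)ᶜ :=
    disjoint_compl_right.mono_left (interior_subset.trans subset_closure)
  exact ((Metric.isPreconnected_ball).subset_left_of_subset_union isOpen_interior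
    isClosed_closure.isOpen_compl hsep hsub ⟨p, Metric.mem_ball_self ha, hp⟩).trans interior_subset

/-- Slopes at distance `b` from the sides of the Newton polygon. -/
def slopes (b : ℝ) : Set Plane := {p | p 0 ≤ -b ∧ p 1 ≤ -b ∧ b ≤ 1 + p 0 + p 1}

/-- Moving from `p` along a coordinate axis by less than `a` stays in the triangle, which bounds
each of the three densities from below by `a`. -/
theorem mem_slopes_of_le_infDist {p : Plane} {a : ℝ} (hp : p ∈ interior newton)
    (h : a ≤ Metric.infDist p (frontier newton)) : p ∈ slopes a := by
  have hb := (ball_subset_of_le_infDist_frontier hp h).trans newton_subset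
  have hmem (j : Fin 2) (t : ℝ) (ht : |t| < a) : p + EuclideanSpace.single j t ∈ Metric.ball p a := by
    simpa using ht
  have hle {u : ℝ} (hu : ∀ t, |t| < a → t ≤ u) (h0 : 0 ≤ u) : a ≤ u := by
    refine le_of_forall_lt fun t ht => ?_
    rcases lt_or_ge t 0 with h' | h'
    · linarith
    · have := hu ((t + a) / 2) (by rw [abs_of_nonneg (by linarith)]; linarith)
      linarith
  obtain ⟨n0, n1, n2⟩ := newton_subset (interior_subset hp)
  refine ⟨?_, ?_, ?_⟩
  · have : a ≤ - p 0 := hle (fun t ht => by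
      have := (hb (hmem 0 t ht)).1
      simp at this
      linarith) (by linarith)
    linarith
  · have : a ≤ - p 1 := hle (fun t ht => by
      have := (hb (hmem 1 t ht)).2.1
      simp at this
      linarith) (by linarith)
    linarith
  · exact hle (fun t ht => by
      have := (hb (hmem 0 (-t) (by rwa [abs_neg]))).2.2
      simp at this
      linarith) (by linarith)

/-! ### The Hessian of the surface tension -/

theorem hasDerivAt_lobachevsky {θ : ℝ} (h0 : 0 < θ) (h1 : θ < Real.pi) :
    HasDerivAt lobachevsky (-Real.log (2 * Real.sin θ)) θ := by
  have hs (s : ℝ) (hs : s ∈ Ioo 0 Real.pi) : 0 < 2 * Real.sin s :=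
    mul_pos two_pos (Real.sin_pos_of_mem_Ioo hs)
  -- The integrand is singular at `0`; integrability comes from that of the logarithm of a
  -- meromorphic function.
  have hint : IntervalIntegrable (fun s => Real.log |2 * Real.sin s|) volume 0 θ := by
    have hm : MeromorphicOn (fun s => 2 * Real.sin s) (uIcc 0 θ) := by
      have h2 : MeromorphicOn Real.sin (uIcc 0 θ) := Real.analyticOnNhd_sin.meromorphicOn
      exact (MeromorphicOn.const 2).mul h2
    exact hm.intervalIntegrable_log_norm
  have hc (s : ℝ) (h : s ∈ Ioo 0 Real.pi) : ContinuousAt (fun s => Real.log |2 * Real.sin s|) s :=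
    ContinuousAt.log (by fun_prop) (abs_pos.2 (hs s h).ne').ne'
  have := (intervalIntegral.integral_hasDerivAt_right hint
    (ContinuousAt.stronglyMeasurableAtFilter isOpen_Ioo hc θ ⟨h0, h1⟩) (hc θ ⟨h0, h1⟩)).neg
  rwa [abs_of_pos (hs θ ⟨h0, h1⟩)] at this

theorem hasDerivAt_log_sin {θ : ℝ} (h0 : 0 < θ) (h1 : θ < Real.pi) :
    HasDerivAt (fun s => Real.log (2 * Real.sin s)) (Real.cos θ / Real.sin θ) θ := by
  have hs : Real.sin θ ≠ 0 := (Real.sin_pos_of_pos_of_lt_pi h0 h1).ne'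
  have := ((Real.hasDerivAt_sin θ).const_mul 2).log (by simpa using hs)
  convert this using 1
  field_simp

/-- The open Newton triangle. -/
def openTriangle : Set Plane := {p | p 0 < 0 ∧ p 1 < 0 ∧ 0 < 1 + p 0 + p 1}

theorem isOpen_openTriangle : IsOpen openTriangle := by
  have h (j : Fin 2) : Continuous fun p : Plane => p j := (coord j).continuous
  exact (isOpen_lt (h 0) continuous_const).inter ((isOpen_lt (h 1) continuous_const).inter
    (isOpen_lt continuous_const ((continuous_const.add (h 0)).add (h 1))))

theorem slopes_subset_openTriangle {b : ℝ} (hb : 0 < b) : slopes b ⊆ openTriangle :=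
  fun _ hp => ⟨by linarith [hp.1], by linarith [hp.2.1], by linarith [hp.2.2]⟩

/-- The angles of the triangle associated with a slope. -/
theorem angle_mem {p : Plane} (hp : p ∈ openTriangle) :
    (∀ j, 0 < Real.pi * (-p j) ∧ Real.pi * (-p j) < Real.pi) ∧
      0 < Real.pi * (1 + p 0 + p 1) ∧ Real.pi * (1 + p 0 + p 1) < Real.pi := by
  obtain ⟨h0, h1, h2⟩ := hp
  have hpi := Real.pi_pos
  refine ⟨fun j => ?_, by positivity, by nlinarith⟩
  fin_cases j <;> simp only [Fin.zero_eta, Fin.mk_one] <;> constructor <;> nlinarith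

theorem hasFDerivAt_angle (p : Plane) (j : Fin 2) :
    HasFDerivAt (fun p : Plane => Real.pi * (-p j)) (Real.pi • -coord j) p :=
  ((hasFDerivAt_coord j p).neg).const_mul _

theorem hasFDerivAt_angle' (p : Plane) :
    HasFDerivAt (fun p : Plane => Real.pi * (1 + p 0 + p 1)) (Real.pi • (coord 0 + coord 1)) p :=
  (((hasFDerivAt_coord 0 p).const_add 1).add (hasFDerivAt_coord 1 p)).const_mul _

theorem pd_sigma {p : Plane} (hp : p ∈ openTriangle) (j : Fin 2) :
    pd j sigma p = Real.log (2 * Real.sin (Real.pi * (1 + p 0 + p 1))) -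
      Real.log (2 * Real.sin (Real.pi * (-p j))) := by
  obtain ⟨h, h2, h2'⟩ := angle_mem hp
  have d (j : Fin 2) := (hasDerivAt_lobachevsky (h j).1 (h j).2).comp_hasFDerivAt p
    (hasFDerivAt_angle p j)
  have d2 := (hasDerivAt_lobachevsky h2 h2').comp_hasFDerivAt p (hasFDerivAt_angle' p)
  have D : HasFDerivAt sigma _ p := (((d 0).add (d 1)).add d2).const_mul (-(1 / Real.pi))
  rw [pd_of_hasFDerivAt D]
  have hpi := Real.pi_ne_zero
  fin_cases j <;> simp [coord_apply] <;> field_simp <;> ring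

/-- The cotangent of `π q`. -/
noncomputable def cotPi (q : ℝ) : ℝ := Real.cos (Real.pi * q) / Real.sin (Real.pi * q)

theorem pd_pd_sigma {p : Plane} (hp : p ∈ openTriangle) (j k : Fin 2) :
    pd j (pd k sigma) p =
      Real.pi * (cotPi (1 + p 0 + p 1) + if j = k then cotPi (-p j) else 0) := by
  have he : pd k sigma =ᶠ[nhds p] fun p => Real.log (2 * Real.sin (Real.pi * (1 + p 0 + p 1))) -
      Real.log (2 * Real.sin (Real.pi * (-p k))) := by
    filter_upwards [isOpen_openTriangle.mem_nhds hp] with q hq using pd_sigma hq k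
  obtain ⟨h, h2, h2'⟩ := angle_mem hp
  have d (j : Fin 2) := (hasDerivAt_log_sin (h j).1 (h j).2).comp_hasFDerivAt p
    (hasFDerivAt_angle p j)
  have d2 := (hasDerivAt_log_sin h2 h2').comp_hasFDerivAt p (hasFDerivAt_angle' p)
  have D : HasFDerivAt (fun p : Plane => Real.log (2 * Real.sin (Real.pi * (1 + p 0 + p 1))) -
      Real.log (2 * Real.sin (Real.pi * (-p k)))) _ p := d2.sub (d k)
  rw [pd_congr he, pd_of_hasFDerivAt D]
  fin_cases j <;> fin_cases k <;> simp [coord_apply, cotPi] <;> ring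

/-- Jordan's inequality on the first half of the interval, and the symmetry `q ↦ 1 - q` on the other
half. -/
theorem two_mul_le_sin {b q : ℝ} (hb : 0 ≤ b) (h0 : b ≤ q) (h1 : q ≤ 1 - b) :
    2 * b ≤ Real.sin (Real.pi * q) := by
  have key {q : ℝ} (h0 : b ≤ q) (h1 : q ≤ 1 / 2) : 2 * b ≤ Real.sin (Real.pi * q) := by
    have hpi := Real.pi_pos
    have := Real.mul_le_sin (x := Real.pi * q) (mul_nonneg hpi.le (hb.trans h0)) (by nlinarith)
    have e : 2 / Real.pi * (Real.pi * q) = 2 * q := by field_simp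
    linarith
  rcases le_total q (1 / 2) with h | h
  · exact key h0 h
  · have := key (q := 1 - q) (by linarith) (by linarith)
    rwa [mul_sub, mul_one, Real.sin_pi_sub] at this

/-- The difference of cotangents is `sin(π(q' - q))` over a product of two sines, each at least
`2b`. -/
theorem abs_cotPi_sub_le {b q q' : ℝ} (hb : 0 < b) (h0 : b ≤ q) (h1 : q ≤ 1 - b) (h0' : b ≤ q')
    (h1' : q' ≤ 1 - b) : |cotPi q - cotPi q'| ≤ Real.pi / (4 * b ^ 2) * |q - q'| := by
  have s := two_mul_le_sin hb.le h0 h1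
  have s' := two_mul_le_sin hb.le h0' h1'
  have hs : 0 < Real.sin (Real.pi * q) := by linarith
  have hs' : 0 < Real.sin (Real.pi * q') := by linarith
  have e : cotPi q - cotPi q' = Real.sin (Real.pi * (q' - q)) /
      (Real.sin (Real.pi * q) * Real.sin (Real.pi * q')) := by
    rw [mul_sub, Real.sin_sub, cotPi, cotPi]
    field_simp
  rw [e, abs_div, abs_of_pos (mul_pos hs hs'), div_mul_eq_mul_div]
  refine div_le_div₀ (by positivity) ?_ (by positivity) (by nlinarith)
  refine Real.abs_sin_le_abs.trans ?_
  rw [abs_mul, abs_of_pos Real.pi_pos, abs_sub_comm]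

/-- The factor `3` collects `2d` from the density `1 + p 0 + p 1` and `d` from the diagonal term. -/
theorem abs_pd_pd_sigma_sub_le {b d : ℝ} (hb : 0 < b) {p p' : Plane} (hp : p ∈ slopes b)
    (hp' : p' ∈ slopes b) (h : ∀ j, |p j - p' j| ≤ d) (j k : Fin 2) :
    |pd j (pd k sigma) p - pd j (pd k sigma) p'| ≤ 3 * Real.pi ^ 2 / (4 * b ^ 2) * d := by
  have hd : 0 ≤ d := (abs_nonneg _).trans (h 0)
  have hL : 0 < Real.pi / (4 * b ^ 2) := by positivity
  have A : |cotPi (1 + p 0 + p 1) - cotPi (1 + p' 0 + p' 1)| ≤ Real.pi / (4 * b ^ 2) * (2 * d) := by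
    refine (abs_cotPi_sub_le hb hp.2.2 (by linarith [hp.1, hp.2.1]) hp'.2.2
      (by linarith [hp'.1, hp'.2.1])).trans (mul_le_mul_of_nonneg_left ?_ hL.le)
    have h0 := abs_le.1 (h 0)
    have h1 := abs_le.1 (h 1)
    rw [abs_le]
    constructor <;> linarith
  have B : |cotPi (-p j) - cotPi (-p' j)| ≤ Real.pi / (4 * b ^ 2) * d := by
    have hj {q : Plane} (hq : q ∈ slopes b) : b ≤ -q j ∧ -q j ≤ 1 - b := by
      obtain ⟨a1, a2, a3⟩ := hq
      fin_cases j <;> simp only [Fin.zero_eta, Fin.mk_one] <;> constructor <;> linarith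
    refine (abs_cotPi_sub_le hb (hj hp).1 (hj hp).2 (hj hp').1 (hj hp').2).trans
      (mul_le_mul_of_nonneg_left ?_ hL.le)
    rw [neg_sub_neg, abs_sub_comm]
    exact h j
  rw [pd_pd_sigma (slopes_subset_openTriangle hb hp), pd_pd_sigma (slopes_subset_openTriangle hb hp'),
    ← mul_sub, abs_mul, abs_of_pos Real.pi_pos]
  have e : 3 * Real.pi ^ 2 / (4 * b ^ 2) * d = Real.pi * (Real.pi / (4 * b ^ 2) * (3 * d)) := by ring
  rw [e]
  refine mul_le_mul_of_nonneg_left ?_ Real.pi_pos.le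
  have A' := abs_le.1 A
  have B' := abs_le.1 B
  rw [abs_le]
  have := mul_nonneg hL.le hd
  split_ifs
  · constructor <;> nlinarith
  · constructor <;> nlinarith

/-- The angle addition formulas for the three angles `π q`, `π q'`, `π q''` with sum `π`. -/
theorem cotPi_add_cotPi {q q' : ℝ} (h : Real.sin (Real.pi * q) ≠ 0)
    (h' : Real.sin (Real.pi * q') ≠ 0) :
    cotPi q + cotPi q' = Real.sin (Real.pi * (1 - q - q')) /
      (Real.sin (Real.pi * q) * Real.sin (Real.pi * q')) := by
  have : Real.pi * (1 - q - q') = Real.pi - (Real.pi * q + Real.pi * q') := by ring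
  rw [this, Real.sin_pi_sub, Real.sin_add, cotPi, cotPi]
  field_simp
  ring

/-- The three angles sum to `π`, so the sum of two cotangents is the sine of the third angle over a
product of sines that is at most one. -/
theorem pd_pd_sigma_diag_ge {b : ℝ} (hb : 0 < b) {p : Plane} (hp : p ∈ slopes b) (j : Fin 2) :
    2 * b * Real.pi ≤ pd j (pd j sigma) p := by
  rw [pd_pd_sigma (slopes_subset_openTriangle hb hp), if_pos rfl]
  have hj : b ≤ -p j ∧ -p j ≤ 1 - b := by
    obtain ⟨a1, a2, a3⟩ := hp
    fin_cases j <;> simp only [Fin.zero_eta, Fin.mk_one] <;> constructor <;> linarith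
  have h3 : b ≤ 1 - (1 + p 0 + p 1) - (-p j) ∧ 1 - (1 + p 0 + p 1) - (-p j) ≤ 1 - b := by
    obtain ⟨a1, a2, a3⟩ := hp
    fin_cases j <;> simp only [Fin.zero_eta, Fin.mk_one] <;> constructor <;> linarith
  have s := two_mul_le_sin hb.le hj.1 hj.2
  have s' := two_mul_le_sin hb.le hp.2.2 (by linarith [hp.1, hp.2.1])
  have s3 := two_mul_le_sin hb.le h3.1 h3.2
  rw [cotPi_add_cotPi (by linarith) (by linarith), mul_comm (2 * b)]
  refine mul_le_mul_of_nonneg_left ?_ Real.pi_pos.le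
  rw [le_div_iff₀ (mul_pos (by linarith) (by linarith))]
  have l1 := Real.sin_le_one (Real.pi * (1 + p 0 + p 1))
  have l2 := Real.sin_le_one (Real.pi * (-p j))
  have : Real.sin (Real.pi * (1 + p 0 + p 1)) * Real.sin (Real.pi * (-p j)) ≤ 1 :=
    mul_le_one₀ l1 (by linarith) l2
  nlinarith

/-- This is the identity `cot A cot B + cot B cot C + cot C cot A = 1` for angles with sum `π`. -/
theorem det_hessian_sigma {p : Plane} (hp : p ∈ openTriangle) :
    pd 0 (pd 0 sigma) p * pd 1 (pd 1 sigma) p - pd 0 (pd 1 sigma) p ^ 2 = Real.pi ^ 2 := by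
  obtain ⟨h, h2, h2'⟩ := angle_mem hp
  have n0 := (Real.sin_pos_of_pos_of_lt_pi (h 0).1 (h 0).2).ne'
  have n1 := (Real.sin_pos_of_pos_of_lt_pi (h 1).1 (h 1).2).ne'
  have n2 := (Real.sin_pos_of_pos_of_lt_pi h2 h2').ne'
  rw [pd_pd_sigma hp, pd_pd_sigma hp, pd_pd_sigma hp]
  simp only [if_true, zero_ne_one, if_false, cotPi]
  have e : Real.pi * (1 + p 0 + p 1) = Real.pi - (Real.pi * (-p 0) + Real.pi * (-p 1)) := by ring
  rw [e, Real.sin_pi_sub, Real.sin_add] at n2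
  rw [e, Real.sin_pi_sub, Real.cos_pi_sub, Real.sin_add, Real.cos_add]
  generalize Real.pi * (-p 0) = A at *
  generalize Real.pi * (-p 1) = B at *
  have hA := Real.sin_sq_add_cos_sq A
  have hB := Real.sin_sq_add_cos_sq B
  obtain ⟨S, hS⟩ : ∃ S, S = Real.sin A * Real.cos B + Real.cos A * Real.sin B := ⟨_, rfl⟩
  rw [← hS] at n2 ⊢
  field_simp
  rw [hS]
  ring

/-- Ellipticity: the Hessian of `σ` pairs nonpositively with negative semidefinite matrices. -/
theorem sum_hessian_sigma_mul_nonpos {p : Plane} (hp : p ∈ openTriangle)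
    (h00 : 0 < pd 0 (pd 0 sigma) p) {X : Fin 2 → Fin 2 → ℝ}
    (hX : ∀ v : Fin 2 → ℝ, ∑ j : Fin 2, ∑ k : Fin 2, v j * v k * X j k ≤ 0) :
    ∑ j : Fin 2, ∑ k : Fin 2, pd j (pd k sigma) p * X j k ≤ 0 := by
  have hs : pd 1 (pd 0 sigma) p = pd 0 (pd 1 sigma) p := by
    rw [pd_pd_sigma hp, pd_pd_sigma hp]; simp
  have hdet := det_hessian_sigma hp
  simp only [Fin.sum_univ_two, hs] at hX ⊢
  set a := pd 0 (pd 0 sigma) p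
  set m := pd 0 (pd 1 sigma) p
  set d := pd 1 (pd 1 sigma) p
  -- With `v = (a, m)` and `e = (0, 1)`, completing the square writes `a` times the Hessian as `v vᵀ
  -- + det · e eᵀ`, and `det = π²`.
  have h1 := hX ![a, m]
  have h2 := hX ![0, 1]
  simp at h1 h2
  have hpi : 0 < Real.pi ^ 2 := by positivity
  by_contra! hc
  have : a * (a * X 0 0 + m * X 0 1 + (m * X 1 0 + d * X 1 1)) =
      (a * a * X 0 0 + a * m * X 0 1 + (m * a * X 1 0 + m * m * X 1 1)) +
        Real.pi ^ 2 * X 1 1 := by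
    rw [← hdet]; ring
  nlinarith [mul_pos h00 hc]

/-! ### Second derivatives of functions in the plane -/

theorem differentiableAt_pd {f : Plane → ℝ} {x : Plane} (hf : ContDiffAt ℝ 2 f x) (k : Fin 2) :
    DifferentiableAt ℝ (pd k f) x := by
  have h : ContDiffAt ℝ 1 (fderiv ℝ f) x := hf.fderiv_right (by norm_num)
  exact (h.differentiableAt one_ne_zero).clm_apply (differentiableAt_const _)

theorem eventually_differentiableAt {f : Plane → ℝ} {x : Plane} (hf : ContDiffAt ℝ 2 f x) :
    ∀ᶠ y in nhds x, DifferentiableAt ℝ f y := by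
  filter_upwards [hf.eventually (by simp)] with y hy using hy.differentiableAt two_ne_zero

theorem pd_add {f g : Plane → ℝ} {x : Plane} (hf : DifferentiableAt ℝ f x)
    (hg : DifferentiableAt ℝ g x) (j : Fin 2) :
    pd j (fun y => f y + g y) x = pd j f x + pd j g x := by
  rw [pd_of_hasFDerivAt (hf.hasFDerivAt.fun_add hg.hasFDerivAt)]
  rfl

theorem pd_mul_sub {f g : Plane → ℝ} {x : Plane} (s : ℝ) (hf : DifferentiableAt ℝ f x)
    (hg : DifferentiableAt ℝ g x) (j : Fin 2) :
    pd j (fun y => s * (f y - g y)) x = s * (pd j f x - pd j g x) := by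
  rw [pd_of_hasFDerivAt ((hf.hasFDerivAt.fun_sub hg.hasFDerivAt).const_mul s)]
  rfl

theorem pd_pd_add {f g : Plane → ℝ} {x : Plane} (hf : ContDiffAt ℝ 2 f x)
    (hg : ContDiffAt ℝ 2 g x) (j k : Fin 2) :
    pd j (pd k fun y => f y + g y) x = pd j (pd k f) x + pd j (pd k g) x := by
  rw [← pd_add (differentiableAt_pd hf k) (differentiableAt_pd hg k)]
  refine pd_congr ?_ j
  filter_upwards [eventually_differentiableAt hf, eventually_differentiableAt hg] with y h1 h2
    using pd_add h1 h2 k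

theorem pd_pd_mul_sub {f g : Plane → ℝ} {x : Plane} (s : ℝ) (hf : ContDiffAt ℝ 2 f x)
    (hg : ContDiffAt ℝ 2 g x) (j k : Fin 2) :
    pd j (pd k fun y => s * (f y - g y)) x = s * (pd j (pd k f) x - pd j (pd k g) x) := by
  rw [← pd_mul_sub s (differentiableAt_pd hf k) (differentiableAt_pd hg k)]
  refine pd_congr ?_ j
  filter_upwards [eventually_differentiableAt hf, eventually_differentiableAt hg] with y h1 h2
    using pd_mul_sub s h1 h2 k

theorem fderiv_eq_sum_pd (f : Plane → ℝ) (x v : Plane) :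
    fderiv ℝ f x v = ∑ k : Fin 2, v k * pd k f x := by
  have hv : v = ∑ k : Fin 2, v k • EuclideanSpace.single k (1 : ℝ) := by
    ext i
    fin_cases i <;> simp
  conv_lhs => rw [hv]
  simp [pd]

/-- Second order necessary condition at a local maximum. -/
theorem sum_pd_pd_nonpos {f : Plane → ℝ} {x : Plane} (hf : ContDiffAt ℝ 2 f x)
    (hmax : IsLocalMax f x) (v : Fin 2 → ℝ) :
    ∑ j : Fin 2, ∑ k : Fin 2, v j * v k * pd j (pd k f) x ≤ 0 := by
  set V : Plane := WithLp.toLp 2 v with hV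
  set c : ℝ → Plane := fun t => x + t • V with hc
  have hc0 : c 0 = x := by simp [hc]
  have hcd (t : ℝ) : HasDerivAt c V t := by
    have := ((hasDerivAt_id t).smul_const V).const_add x
    rwa [one_smul] at this
  have hct : Filter.Tendsto c (nhds 0) (nhds x) := by
    simpa [hc0] using (hcd 0).continuousAt.tendsto
  set g : ℝ → ℝ := fun t => f (c t) with hg
  have hline {F : Plane → ℝ} {t : ℝ} (hF : DifferentiableAt ℝ F (c t)) :
      HasDerivAt (fun t => F (c t)) (∑ k : Fin 2, v k * pd k F (c t)) t := by
    have := hF.hasFDerivAt.comp_hasDerivAt t (hcd t)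
    rwa [fderiv_eq_sum_pd] at this
  have h1 : deriv g =ᶠ[nhds 0] fun t => ∑ k : Fin 2, v k * pd k f (c t) := by
    filter_upwards [hct.eventually (eventually_differentiableAt hf)] with t ht
    exact (hline ht).deriv
  have h2 : deriv (deriv g) 0 = ∑ j : Fin 2, ∑ k : Fin 2, v j * v k * pd j (pd k f) x := by
    rw [h1.deriv_eq]
    have : HasDerivAt (fun t => ∑ k : Fin 2, v k * pd k f (c t))
        (∑ k : Fin 2, v k * ∑ j : Fin 2, v j * pd j (pd k f) (c 0)) 0 :=
      HasDerivAt.fun_sum fun k _ =>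
        (hline (by rw [hc0]; exact differentiableAt_pd hf k)).const_mul _
    rw [this.deriv, hc0]
    simp only [Fin.sum_univ_two]
    ring
  have gmax : IsLocalMax g 0 := by
    have := hct.eventually hmax
    simpa only [IsLocalMax, IsMaxFilter, hg, hc0] using this
  rw [← h2]
  -- A positive second derivative would make `0` a local minimum as well, so `g` would be locally
  -- constant and its second derivative zero.
  by_contra! hpos
  have gmin := isLocalMin_of_deriv_deriv_pos hpos gmax.deriv_eq_zero
    (hline (by rw [hc0]; exact hf.differentiableAt two_ne_zero)).continuousAt
  have hconst : g =ᶠ[nhds 0] fun _ => g 0 := by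
    filter_upwards [gmax, gmin] with t h h' using le_antisymm h h'
  have h3 : deriv g =ᶠ[nhds 0] fun _ => 0 := by
    simpa using hconst.deriv
  rw [h3.deriv_eq] at hpos
  simp at hpos

/-! ### Quadratic perturbations -/

/-- The quadratic polynomial `c + ∑ m_j (x_j - w_j) - ∑ n_j (x_j - w_j)²`. -/
noncomputable def quadPoly (c : ℝ) (m n : Fin 2 → ℝ) (w x : Plane) : ℝ :=
  c + ∑ j : Fin 2, m j * (x j - w j) - ∑ j : Fin 2, n j * (x j - w j) ^ 2

theorem contDiff_quadPoly (c : ℝ) (m n : Fin 2 → ℝ) (w : Plane) : ContDiff ℝ 2 (quadPoly c m n w) := by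
  have h (j : Fin 2) : ContDiff ℝ 2 fun x : Plane => x j := (coord j).contDiff
  unfold quadPoly
  exact (contDiff_const.add (ContDiff.sum fun j _ => contDiff_const.mul ((h j).sub contDiff_const))).sub
    (ContDiff.sum fun j _ => contDiff_const.mul (((h j).sub contDiff_const).pow 2))

theorem pd_quadPoly (c : ℝ) (m n : Fin 2 → ℝ) (w x : Plane) (j : Fin 2) :
    pd j (quadPoly c m n w) x = m j - 2 * n j * (x j - w j) := by
  have h (j : Fin 2) := (hasFDerivAt_coord j x).sub_const (w j)
  have D : HasFDerivAt (quadPoly c m n w) _ x :=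
    ((HasFDerivAt.fun_sum (u := Finset.univ) fun j _ => (h j).const_mul (m j)).const_add c).sub
      (HasFDerivAt.fun_sum (u := Finset.univ) fun j _ => ((h j).pow 2).const_mul (n j))
  rw [pd_of_hasFDerivAt D]
  fin_cases j <;> simp [coord_apply] <;> ring

theorem pd_pd_quadPoly (c : ℝ) (m n : Fin 2 → ℝ) (w x : Plane) (j k : Fin 2) :
    pd j (pd k (quadPoly c m n w)) x = if j = k then -2 * n j else 0 := by
  have e : pd k (quadPoly c m n w) = fun x => m k - 2 * n k * (x k - w k) :=
    funext fun x => pd_quadPoly c m n w x k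
  have D : HasFDerivAt (fun x : Plane => m k - 2 * n k * (x k - w k)) _ x :=
    (((hasFDerivAt_coord k x).sub_const (w k)).const_mul (2 * n k)).const_sub (m k)
  rw [e, pd_of_hasFDerivAt D]
  fin_cases j <;> fin_cases k <;> simp [coord_apply]

/-! ### Comparison of limit shapes with quadratic barriers -/

/-- Maximum principle against a barrier that equals `f` on the frontier. In `hM`, the left side
bounds the change of coefficients between `∇φ` and `∇u`, and the right side bounds the gain from the
curvature of the barrier, up to common factors. -/
theorem quad_barrier {U E : Set Plane} {φ f u : Plane → ℝ} {a H N r d c₀ : ℝ} {m κ : Fin 2 → ℝ}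
    {w : Plane} (hU : IsOpen U) (hφ : ContDiffOn ℝ 2 φ U) (hEL : SolvesEL U φ) (ha : 0 < a)
    (hslope : ∀ x ∈ U, grad φ x ∈ slopes a) (hE : IsCompact E) (hEU : E ⊆ U)
    (hH : ∀ x ∈ E, ∀ j k, |pd j (pd k φ) x| ≤ H) (hu : IsLimitShape E f u)
    (hf : ∀ x, f x = φ x + quadPoly c₀ m 0 w x)
    (hEfr : ∀ x ∈ frontier E, ∑ j : Fin 2, κ j * (x j - w j) ^ 2 = r ^ 2)
    (hκ : ∀ j, 0 ≤ κ j) (hN : 0 ≤ N)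
    (hd : ∀ x ∈ E, ∀ j, |m j| + 2 * N * κ j * |x j - w j| ≤ d) (hda : d ≤ a / 4)
    (hM : 12 * H * Real.pi * d < 2 * N * (κ 0 + κ 1) * a ^ 3)
    (x : Plane) (hx : x ∈ E) :
    |u x - f x| ≤ N * (r ^ 2 - ∑ j : Fin 2, κ j * (x j - w j) ^ 2) := by
  -- The sign `s = ±1` treats the upper and the lower barrier together.
  suffices key : ∀ s : ℝ, s ^ 2 = 1 → ∀ x ∈ E,
      s * (u x - f x) ≤ N * (r ^ 2 - ∑ j : Fin 2, κ j * (x j - w j) ^ 2) by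
    have h1 := key 1 (by norm_num) x hx
    have h2 := key (-1) (by norm_num) x hx
    rw [abs_le]
    constructor <;> linarith
  clear hx x
  intro s hs
  set q := quadPoly (c₀ + s * N * r ^ 2) m (fun j => s * N * κ j) w with hq
  have hfq (x : Plane) : f x + s * N * (r ^ 2 - ∑ j : Fin 2, κ j * (x j - w j) ^ 2) = φ x + q x := by
    simp only [hf, hq, quadPoly, Fin.sum_univ_two, Pi.zero_apply]
    ring
  set F : Plane → ℝ := fun x => s * (u x - (φ x + q x)) with hF
  suffices hle : ∀ x ∈ E, F x ≤ 0 by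
    intro x hx
    have := hle x hx
    simp only [hF, ← hfq x] at this
    linear_combination this + N * (r ^ 2 - ∑ j : Fin 2, κ j * (x j - w j) ^ 2) * hs
  rcases E.eq_empty_or_nonempty with rfl | hne
  · simp
  have hqC : ContDiff ℝ 2 q := contDiff_quadPoly _ _ _ _
  have hFc : ContinuousOn F E :=
    continuousOn_const.mul (hu.continuousOn.sub ((hφ.continuousOn.mono hEU).add
      hqC.continuous.continuousOn))
  obtain ⟨y, hy, hmax⟩ := hE.exists_isMaxOn hne hFc
  refine fun x hx => (hmax hx).trans ?_
  by_cases hyi : y ∈ interior E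
  swap
  · have hfr : y ∈ frontier E := ⟨subset_closure hy, hyi⟩
    simp only [hF, ← hfq, hu.boundary y hfr, hEfr y hfr]
    simp
  -- An interior maximum is impossible. There the gradients of `u` and of the barrier agree, so `∇u`
  -- is within `d` of `∇φ`, and ellipticity contradicts `hM`.
  exfalso
  have hloc : IsLocalMax F y := hmax.isLocalMax (mem_interior_iff_mem_nhds.1 hyi)
  have uC : ContDiffAt ℝ 2 u y := hu.contDiffOn.contDiffAt (isOpen_interior.mem_nhds hyi)
  have φC : ContDiffAt ℝ 2 φ y := hφ.contDiffAt (hU.mem_nhds (hEU hy))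
  have BC : ContDiffAt ℝ 2 (fun x => φ x + q x) y := φC.add hqC.contDiffAt
  have FC : ContDiffAt ℝ 2 F y := contDiffAt_const.mul (uC.sub BC)
  have hs0 : s ≠ 0 := by rintro rfl; norm_num at hs
  have hpd (j : Fin 2) : pd j u y = pd j φ y + (m j - 2 * (s * N * κ j) * (y j - w j)) := by
    have h0 : pd j F y = 0 := by rw [pd, hloc.fderiv_eq_zero]; rfl
    rw [hF, pd_mul_sub s (uC.differentiableAt two_ne_zero) (BC.differentiableAt two_ne_zero),
      pd_add (φC.differentiableAt two_ne_zero) (hqC.differentiable two_ne_zero y), pd_quadPoly] at h0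
    have := (mul_eq_zero.1 h0).resolve_left hs0
    linarith
  have habs : |s| = 1 := by
    rw [← sq_eq_sq₀ (abs_nonneg s) zero_le_one, sq_abs, hs, one_pow]
  have hdiff (j : Fin 2) : |grad u y j - grad φ y j| ≤ d := by
    have e : grad u y j - grad φ y j = m j - 2 * (s * N * κ j) * (y j - w j) := by
      have := hpd j
      fin_cases j <;> simp [grad] at this ⊢ <;> linarith
    rw [e]
    refine (abs_sub _ _).trans (le_trans (le_of_eq ?_) (hd y hy j))
    rw [abs_mul, abs_mul, abs_mul, abs_mul, habs, abs_of_nonneg hN, abs_of_nonneg (hκ j),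
      abs_two]
    ring
  have hb : 0 < a / 2 := by linarith
  have hpφ : grad φ y ∈ slopes (a / 2) := by
    obtain ⟨h1, h2, h3⟩ := hslope y (hEU hy)
    exact ⟨by linarith, by linarith, by linarith⟩
  have hpu : grad u y ∈ slopes (a / 2) := by
    obtain ⟨h1, h2, h3⟩ := hslope y (hEU hy)
    have d0 := abs_le.1 (hdiff 0)
    have d1 := abs_le.1 (hdiff 1)
    exact ⟨by linarith, by linarith, by linarith⟩
  have hT := slopes_subset_openTriangle hb hpu
  have g0 := pd_pd_sigma_diag_ge hb hpu 0
  have g1 := pd_pd_sigma_diag_ge hb hpu 1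
  have hell := sum_hessian_sigma_mul_nonpos hT (by
    have : 0 < 2 * (a / 2) * Real.pi := by positivity
    linarith) (sum_pd_pd_nonpos FC hloc)
  have hu0 := (hu.solves y hyi).2
  have hφ0 := (hEL y (hEU hy)).2
  have hlip (j k : Fin 2) := abs_pd_pd_sigma_sub_le hb hpu hpφ hdiff j k
  have hX (j k : Fin 2) : pd j (pd k F) y = s * (pd j (pd k u) y - (pd j (pd k φ) y +
      if j = k then -2 * (s * N * κ j) else 0)) := by
    rw [hF, pd_pd_mul_sub s uC BC, pd_pd_add φC hqC.contDiffAt, pd_pd_quadPoly]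
  simp only [hX] at hell
  have hprod (j k : Fin 2) : |(pd j (pd k sigma) (grad u y) - pd j (pd k sigma) (grad φ y)) *
      pd j (pd k φ) y| ≤ 3 * Real.pi ^ 2 / (4 * (a / 2) ^ 2) * d * H := by
    rw [abs_mul]
    exact mul_le_mul (hlip j k) (hH y hy j k) (abs_nonneg _) ((abs_nonneg _).trans (hlip j k))
  set T := ∑ j : Fin 2, ∑ k : Fin 2, (pd j (pd k sigma) (grad u y) - pd j (pd k sigma) (grad φ y)) *
      pd j (pd k φ) y with hTdef
  have hTle : |T| ≤ 4 * (3 * Real.pi ^ 2 / (4 * (a / 2) ^ 2) * d * H) := by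
    have := fun j k => abs_le.1 (hprod j k)
    have a00 := this 0 0
    have a01 := this 0 1
    have a10 := this 1 0
    have a11 := this 1 1
    rw [hTdef, abs_le]
    simp only [Fin.sum_univ_two]
    constructor <;> linarith
  have hsT : s * T ≤ 4 * (3 * Real.pi ^ 2 / (4 * (a / 2) ^ 2) * d * H) := by
    refine (le_abs_self _).trans ?_
    rwa [abs_mul, habs, one_mul]
  -- The equation for `u` removes its second derivatives, and subtracting the equation for `φ`
  -- leaves only the difference of coefficients in `T`.
  have hmain : 2 * N * (pd 0 (pd 0 sigma) (grad u y) * κ 0 + pd 1 (pd 1 sigma) (grad u y) * κ 1)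
      ≤ s * T := by
    simp only [hTdef, Fin.sum_univ_two, Fin.isValue, if_true, zero_ne_one, one_ne_zero, if_false]
      at hell hu0 hφ0 ⊢
    linear_combination hell - s * hu0 + s * hφ0 - (2 * N * (pd 0 (pd 0 sigma) (grad u y) * κ 0 +
      pd 1 (pd 1 sigma) (grad u y) * κ 1)) * hs
  have hlow : 2 * N * (a * Real.pi * (κ 0 + κ 1)) ≤
      2 * N * (pd 0 (pd 0 sigma) (grad u y) * κ 0 + pd 1 (pd 1 sigma) (grad u y) * κ 1) := by
    refine mul_le_mul_of_nonneg_left ?_ (by positivity)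
    have := mul_le_mul_of_nonneg_right g0 (hκ 0)
    have := mul_le_mul_of_nonneg_right g1 (hκ 1)
    linarith
  have hfin := hlow.trans (hmain.trans hsT)
  have e : 4 * (3 * Real.pi ^ 2 / (4 * (a / 2) ^ 2) * d * H) = 12 * Real.pi ^ 2 * d * H / a ^ 2 := by
    field_simp
    ring
  rw [e, le_div_iff₀ (by positivity)] at hfin
  have hpi := Real.pi_pos
  nlinarith [mul_lt_mul_of_pos_left hM hpi]

/-! ### The concave profile and the ellipses -/

theorem hasFDerivAt_exp_coord (ξ : ℝ) (j : Fin 2) (x : Plane) :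
    HasFDerivAt (fun y : Plane => Real.exp (y j / ξ)) ((Real.exp (x j / ξ) * ξ⁻¹) • coord j) x := by
  have h := ((Real.hasDerivAt_exp (x j / ξ)).comp (x j)
    ((hasDerivAt_id (x j)).div_const ξ)).comp_hasFDerivAt x (hasFDerivAt_coord j x)
  simpa [Function.comp_def] using h

theorem pd_psi (ξ c : ℝ) (j : Fin 2) (x : Plane) :
    pd j (psi ξ c) x = -(Real.exp (x j / ξ) / ξ) := by
  have D : HasFDerivAt (psi ξ c) _ x :=
    ((hasFDerivAt_exp_coord ξ 0 x).const_sub c).sub (hasFDerivAt_exp_coord ξ 1 x)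
  rw [pd_of_hasFDerivAt D]
  fin_cases j <;> simp [coord_apply, div_eq_mul_inv]

theorem differentiable_psi (ξ c : ℝ) : Differentiable ℝ (psi ξ c) := fun x =>
  (((hasFDerivAt_exp_coord ξ 0 x).const_sub c).sub (hasFDerivAt_exp_coord ξ 1 x)).differentiableAt

/-- The coefficients of the quadratic form `quad`. -/
noncomputable def curv (ξ : ℝ) (w : Plane) (j : Fin 2) : ℝ := Real.exp (w j / ξ) / ξ ^ 2

theorem curv_pos {ξ : ℝ} (hξ : 0 < ξ) (w : Plane) (j : Fin 2) : 0 < curv ξ w j :=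
  div_pos (Real.exp_pos _) (by positivity)

theorem pd_pd_psi (ξ c : ℝ) (j k : Fin 2) (x : Plane) :
    pd j (pd k (psi ξ c)) x = if j = k then -curv ξ x j else 0 := by
  have e : pd k (psi ξ c) = fun x => -(Real.exp (x k / ξ) * ξ⁻¹) := funext (pd_psi ξ c k)
  have D : HasFDerivAt (fun x : Plane => -(Real.exp (x k / ξ) * ξ⁻¹)) _ x :=
    ((hasFDerivAt_exp_coord ξ k x).mul_const ξ⁻¹).neg
  rw [e, pd_of_hasFDerivAt D]
  fin_cases j <;> fin_cases k <;> simp [coord_apply, curv] <;> field_simp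

theorem quad_eq (ξ c : ℝ) (w x : Plane) :
    quad ξ c w x = ∑ j : Fin 2, curv ξ w j * (x j - w j) ^ 2 := by
  simp only [quad, pd_pd_psi, Fin.sum_univ_two]
  simp
  ring

theorem continuous_quad (ξ c : ℝ) (w : Plane) : Continuous (quad ξ c w) := by
  have h (j : Fin 2) : Continuous fun x : Plane => x j := (coord j).continuous
  rw [funext (quad_eq ξ c w)]
  exact continuous_finsetSum _ fun j _ => continuous_const.mul (((h j).sub continuous_const).pow 2)

theorem bdryDatum_eq (φ : Plane → ℝ) (ξ c ε r : ℝ) (w x : Plane) :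
    bdryDatum φ ξ c ε r w x = φ x +
      quadPoly (ε * (psi ξ c w - r ^ 2 / 2)) (fun j => ε * pd j (psi ξ c) w) 0 w x := by
  simp only [bdryDatum, quadPoly, Fin.sum_univ_two, Pi.zero_apply]
  ring

theorem abs_coord_sub_le_dist (x w : Plane) (j : Fin 2) : |x j - w j| ≤ dist x w := by
  rw [dist_eq_norm]
  exact PiLp.norm_apply_le (x - w) j

theorem ellipse_subset_closedBall {ξ c κ r : ℝ} {w : Plane} (hκ : 0 < κ) (hr : 0 ≤ r)
    (h : ∀ j, κ ≤ curv ξ w j) : ellipse ξ c w r ⊆ Metric.closedBall w (r / Real.sqrt κ) := by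
  intro x hx
  have hx' : quad ξ c w x ≤ r ^ 2 := hx
  rw [quad_eq, Fin.sum_univ_two] at hx'
  rw [Metric.mem_closedBall, EuclideanSpace.dist_eq]
  refine Real.sqrt_le_iff.2 ⟨by positivity, ?_⟩
  rw [div_pow, Real.sq_sqrt hκ.le, le_div_iff₀ hκ, Fin.sum_univ_two, Real.dist_eq, Real.dist_eq,
    sq_abs, sq_abs]
  have := mul_le_mul_of_nonneg_right (h 0) (sq_nonneg (x 0 - w 0))
  have := mul_le_mul_of_nonneg_right (h 1) (sq_nonneg (x 1 - w 1))
  linarith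

theorem ellipse_half_subset {ξ c r : ℝ} {w : Plane} : ellipse ξ c w (r / 2) ⊆ ellipse ξ c w r := by
  intro x (hx : quad ξ c w x ≤ (r / 2) ^ 2)
  exact hx.trans (by nlinarith [sq_nonneg r])

/-- Uses `exp t ≤ 1 + t + t²` for `|t| ≤ 1`. The second-order Taylor term would be `Q_w / 2`; the
full `Q_w` pays for the remainder. -/
theorem psi_ge {ξ c : ℝ} {w x : Plane} (hξ : 0 < ξ) (h : dist x w ≤ ξ) :
    psi ξ c w + ∑ j : Fin 2, pd j (psi ξ c) w * (x j - w j) - quad ξ c w x ≤ psi ξ c x := by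
  have key (j : Fin 2) : Real.exp (x j / ξ) ≤ Real.exp (w j / ξ) +
      Real.exp (w j / ξ) / ξ * (x j - w j) + curv ξ w j * (x j - w j) ^ 2 := by
    have ht : |(x j - w j) / ξ| ≤ 1 := by
      rw [abs_div, abs_of_pos hξ, div_le_one hξ]
      exact (abs_coord_sub_le_dist x w j).trans h
    have h1 := (abs_le.1 (Real.abs_exp_sub_one_sub_id_le ht)).2
    have e : Real.exp (x j / ξ) = Real.exp (w j / ξ) * Real.exp ((x j - w j) / ξ) := by
      rw [← Real.exp_add]; congr 1; ring
    rw [e]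
    calc Real.exp (w j / ξ) * Real.exp ((x j - w j) / ξ)
        ≤ Real.exp (w j / ξ) * (1 + (x j - w j) / ξ + ((x j - w j) / ξ) ^ 2) :=
          mul_le_mul_of_nonneg_left (by linarith) (Real.exp_pos _).le
      _ = _ := by rw [curv]; field_simp
  rw [quad_eq]
  simp only [pd_psi, Fin.sum_univ_two, psi]
  linarith [key 0, key 1]

/-- Upper and lower bounds for the limit shape in a small ellipse. -/
theorem limitShape_bounds {U : Set Plane} {φ u : Plane → ℝ} {a H M P ε r ξ c κ κ' : ℝ}
    {w : Plane} (hU : IsOpen U) (hφ : ContDiffOn ℝ 2 φ U) (hEL : SolvesEL U φ) (ha : 0 < a)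
    (hslope : ∀ x ∈ U, grad φ x ∈ slopes a) (hξ : 0 < ξ)
    (hEU : Metric.closedBall w (r / Real.sqrt κ) ⊆ U)
    (hH : ∀ x ∈ Metric.closedBall w (r / Real.sqrt κ), ∀ j k, |pd j (pd k φ) x| ≤ H)
    (hu : IsLimitShape (ellipse ξ c w r) (bdryDatum φ ξ c ε r w) u)
    (hr : 0 ≤ r) (hκ : 0 < κ) (hκw : ∀ j, κ ≤ curv ξ w j) (hκw' : ∀ j, curv ξ w j ≤ κ')
    (hP : ∀ j, |pd j (psi ξ c) w| ≤ P) (hε : 0 < ε) (hεa : ε * (P + 1) ≤ a / 4) (hM : 0 ≤ M)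
    (hMH : 12 * H * Real.pi * (P + 1) < 4 * M * κ * a ^ 3)
    (hr1 : 2 * M * κ' * (r / Real.sqrt κ) ≤ 1) (hr2 : r / Real.sqrt κ ≤ ξ)
    (hr3 : (M + 1) * r ^ 2 ≤ 1 / 4) (hr4 : P * (r / Real.sqrt κ) ≤ 1 / 8)
    (hψ : 1 ≤ psi ξ c w) {x : Plane} (hx : x ∈ ellipse ξ c w r) :
    φ x + ε / 2 ≤ u x ∧ u x ≤ φ x + ε * psi ξ c x + (M + 1) * (ε * r ^ 2) := by
  set ℓ := r / Real.sqrt κ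
  have hEB := ellipse_subset_closedBall (c := c) hκ hr hκw
  have hcl : IsClosed (ellipse ξ c w r) := isClosed_le (continuous_quad ξ c w) continuous_const
  have hcpt : IsCompact (ellipse ξ c w r) :=
    (isCompact_closedBall w ℓ).of_isClosed_subset hcl hEB
  have hfr : ∀ y ∈ frontier (ellipse ξ c w r), ∑ j : Fin 2, curv ξ w j * (y j - w j) ^ 2 = r ^ 2 := by
    intro y hy
    rw [← quad_eq ξ c]
    exact frontier_le_subset_eq (continuous_quad ξ c w) continuous_const hy
  have hco {y : Plane} (hy : y ∈ ellipse ξ c w r) (j : Fin 2) : |y j - w j| ≤ ℓ :=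
    (abs_coord_sub_le_dist y w j).trans (hEB hy)
  -- The barrier height is `N = ε M`. In `d = ε (P + 1)`, `P` bounds the slope of `ψ` at `w` and `1`
  -- bounds the slope of the bump divided by `ε`. Both sides of `hM` are then linear in `ε`, so `M`
  -- need not depend on it.
  have hbar := quad_barrier hU hφ hEL ha hslope hcpt (hEB.trans hEU) (fun y hy => hH y (hEB hy)) hu
    (bdryDatum_eq φ ξ c ε r w) hfr (fun j => (curv_pos hξ w j).le) (N := ε * M) (by positivity)
    (d := ε * (P + 1)) (fun y hy j => by
      have h1 : 2 * M * curv ξ w j * |y j - w j| ≤ 1 := by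
        refine le_trans ?_ hr1
        exact mul_le_mul (mul_le_mul_of_nonneg_left (hκw' j) (by positivity)) (hco hy j)
          (abs_nonneg _) (mul_nonneg (by positivity) ((curv_pos hξ w j).le.trans (hκw' j)))
      rw [abs_mul, abs_of_pos hε]
      calc ε * |pd j (psi ξ c) w| + 2 * (ε * M) * curv ξ w j * |y j - w j|
          = ε * (|pd j (psi ξ c) w| + 2 * M * curv ξ w j * |y j - w j|) := by ring
        _ ≤ ε * (P + 1) := mul_le_mul_of_nonneg_left (add_le_add (hP j) h1) hε.le) hεa
    (by
      have h1 : 4 * M * κ * a ^ 3 ≤ 2 * M * (curv ξ w 0 + curv ξ w 1) * a ^ 3 := by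
        refine mul_le_mul_of_nonneg_right ?_ (by positivity)
        have := mul_le_mul_of_nonneg_left (add_le_add (hκw 0) (hκw 1)) hM
        linarith
      have := mul_lt_mul_of_pos_left (hMH.trans_le h1) hε
      linarith) x hx
  rw [← quad_eq ξ c] at hbar
  have hQ0 : 0 ≤ quad ξ c w x := by
    rw [quad_eq]
    exact Finset.sum_nonneg fun j _ => mul_nonneg (curv_pos hξ w j).le (sq_nonneg _)
  have hQr : quad ξ c w x ≤ r ^ 2 := hx
  have hεM : 0 ≤ ε * M := by positivity
  have hb : |u x - bdryDatum φ ξ c ε r w x| ≤ ε * M * r ^ 2 :=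
    hbar.trans (mul_le_mul_of_nonneg_left (by linarith) hεM)
  obtain ⟨b1, b2⟩ := abs_le.1 hb
  have hψx := psi_ge (c := c) (x := x) hξ ((hEB hx).trans hr2)
  simp only [bdryDatum] at b1 b2
  set L := ∑ j : Fin 2, pd j (psi ξ c) w * (x j - w j)
  have hL : |L| ≤ 1 / 4 := by
    have h1 (j : Fin 2) : |pd j (psi ξ c) w * (x j - w j)| ≤ 1 / 8 := by
      rw [abs_mul]
      exact (mul_le_mul (hP j) (hco hx j) (abs_nonneg _) ((abs_nonneg _).trans (hP j))).trans hr4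
    have h2 := abs_le.1 (h1 0)
    have h3 := abs_le.1 (h1 1)
    simp only [L, Fin.sum_univ_two]
    rw [abs_le]
    constructor <;> linarith
  have hr0 := sq_nonneg r
  constructor
  · have h1 : 1 / 2 ≤ psi ξ c w - r ^ 2 / 2 + L - M * r ^ 2 := by
      linarith [(abs_le.1 hL).1]
    have := mul_le_mul_of_nonneg_left h1 hε.le
    linarith
  · have h1 : psi ξ c w - r ^ 2 / 2 + L ≤ psi ξ c x + r ^ 2 := by linarith
    have := mul_le_mul_of_nonneg_left h1 hε.le
    linarith

/-! ### Discretizations -/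

theorem pos_apply (δ : ℝ) (z : Vertex) : pos δ z 0 = δ * z.1 ∧ pos δ z 1 = δ * z.2 := by
  simp [pos]

theorem finite_sites {δ : ℝ} (hδ : 0 < δ) {D : Set Plane} (hD : Bornology.IsBounded D) :
    (sites δ D).Finite := by
  obtain ⟨R, hR⟩ := hD.subset_closedBall 0
  refine ((finite_Icc (-⌈R / δ⌉) ⌈R / δ⌉).prod (finite_Icc (-⌈R / δ⌉) ⌈R / δ⌉)).subset
    fun z hz => ?_
  have key (n : ℤ) (h : |δ * (n : ℝ)| ≤ R) : n ∈ Icc (-⌈R / δ⌉) ⌈R / δ⌉ := by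
    rw [abs_mul, abs_of_pos hδ, ← le_div_iff₀' hδ] at h
    have h1 : ((|n| : ℤ) : ℝ) ≤ ⌈R / δ⌉ := by
      push_cast
      exact h.trans (Int.le_ceil _)
    exact abs_le.1 (by exact_mod_cast h1)
  have hc (j : Fin 2) : |pos δ z j| ≤ R := by
    have := (abs_coord_sub_le_dist (pos δ z) 0 j).trans (hR hz)
    simpa using this
  exact ⟨key _ (by simpa [pos_apply] using hc 0), key _ (by simpa [pos_apply] using hc 1)⟩

/-- Rounding down a function with slopes in the Newton polygon yields a height function. -/
theorem isHeight_floor {δ : ℝ} (hδ : 0 < δ) {A : Set Vertex} {V : Set Plane} {F : Plane → ℝ}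
    (hF : ∀ x ∈ V, DifferentiableAt ℝ F x) (hs : ∀ x ∈ V, grad F x ∈ slopes 0)
    (hseg : ∀ x ∈ A, ∀ y ∈ A, Nbr x y → segment ℝ (pos δ y) (pos δ x) ⊆ V) :
    IsHeight A fun x => ⌊F (pos δ x) / δ⌋ := by
  -- Along an edge, `F / δ` changes by `p 0`, `p 1` or `-(p 0 + p 1)` for a slope `p` in the
  -- triangle. Rounding down preserves these bounds because they are integers.
  have mvt (x y : A) (h : Nbr (x : Vertex) y) : ∃ p ∈ slopes 0,
      F (pos δ x) / δ - F (pos δ y) / δ =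
        p 0 * ((x : Vertex) - y).1 + p 1 * ((x : Vertex) - y).2 := by
    have hsub := hseg x x.2 y y.2 h
    obtain ⟨z, hz, e⟩ := domain_mvt (f := F) (f' := fun z => fderiv ℝ F z)
      (fun z hz => (hF z (hsub hz)).hasFDerivAt.hasFDerivWithinAt)
      (convex_segment (pos δ y) (pos δ x)) (left_mem_segment ℝ _ _) (right_mem_segment ℝ _ _)
    refine ⟨grad F z, hs z (hsub hz), ?_⟩
    rw [fderiv_eq_sum_pd, Fin.sum_univ_two] at e
    rw [← sub_div, e]
    simp [grad, pos_apply]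
    field_simp
  have fl {s t : ℝ} (h1 : s ≤ t) (h2 : t ≤ s + 1) : ⌊s⌋ ≤ ⌊t⌋ ∧ ⌊t⌋ ≤ ⌊s⌋ + 1 := by
    refine ⟨Int.floor_mono h1, ?_⟩
    rw [← Int.floor_add_one]
    exact Int.floor_mono h2
  rw [isHeight_iff]
  refine fun x y => ⟨fun h => ?_, fun h => ?_, fun h => ?_⟩
  · obtain ⟨p, ⟨p0, p1, p2⟩, e⟩ := mvt x y (Nbr.of_e₁ h).1
    rw [h] at e
    simp [e₁] at e
    exact fl (by linarith) (by linarith)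
  · obtain ⟨p, ⟨p0, p1, p2⟩, e⟩ := mvt x y (Nbr.of_e₂ h).1
    rw [h] at e
    simp [e₂] at e
    exact fl (by linarith) (by linarith)
  · obtain ⟨p, ⟨p0, p1, p2⟩, e⟩ := mvt x y (Nbr.of_e₃ h).1
    rw [h] at e
    simp [e₃] at e
    exact fl (by linarith) (by linarith)

theorem dist_pos_le_of_nbr {δ : ℝ} (hδ : 0 < δ) {x y : Vertex} (h : Nbr x y) :
    dist (pos δ y) (pos δ x) ≤ 2 * δ := by
  have hc (h1 : |((y.1 : ℝ) - x.1)| ≤ 1) (h2 : |((y.2 : ℝ) - x.2)| ≤ 1) :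
      dist (pos δ y) (pos δ x) ≤ 2 * δ := by
    rw [EuclideanSpace.dist_eq]
    refine Real.sqrt_le_iff.2 ⟨by positivity, ?_⟩
    simp only [Fin.sum_univ_two, Real.dist_eq, sq_abs, pos_apply, ← mul_sub, mul_pow]
    have := (sq_le_one_iff_abs_le_one _).2 h1
    have := (sq_le_one_iff_abs_le_one _).2 h2
    nlinarith [sq_nonneg δ]
  have e1 : ((y - x).1 : ℝ) = (y.1 : ℝ) - x.1 := by simp
  have e2 : ((y - x).2 : ℝ) = (y.2 : ℝ) - x.2 := by simp
  have e1' : ((x - y).1 : ℝ) = (x.1 : ℝ) - y.1 := by simp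
  have e2' : ((x - y).2 : ℝ) = (x.2 : ℝ) - y.2 := by simp
  rcases h with (h | h | h) | (h | h | h)
  all_goals
    refine hc ?_ ?_
    all_goals
      first
      | rw [← e1, h]; simp [e₁, e₂, e₃]
      | rw [← e2, h]; simp [e₁, e₂, e₃]
      | rw [abs_sub_comm, ← e1', h]; simp [e₁, e₂, e₃]
      | rw [abs_sub_comm, ← e2', h]; simp [e₁, e₂, e₃]

/-! ### Scales -/

/-- With `s = δ^η` and `D = δ^{1-4η}`, one has `δ^{1-2η} = D s²`, `ε_i r_i² = D s³`, `δ = D s⁴`, and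
`i ≤ i_max` gives `ε_i ≥ D`. Every requirement becomes a polynomial inequality for small `s`. -/
theorem exists_scale {η ε₀ M K r₀ ρ : ℝ} (hη : 0 < η) (hM : 0 ≤ M) (hK : 0 < K)
    (hr₀ : 0 < r₀) (hρ : 0 < ρ) :
    ∃ δ₀ : ℝ, 0 < δ₀ ∧ ∀ δ : ℝ, 0 < δ → δ < δ₀ → δ ≤ ρ ∧
      ∀ i : ℕ, (i : ℤ) ≤ iMax η ε₀ δ →
        0 < epsI ε₀ δ i ∧ epsI ε₀ δ i ≤ ε₀ ∧ 0 ≤ rI η ε₀ δ i ∧ rI η ε₀ δ i ≤ r₀ ∧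
        (M + 1) * (epsI ε₀ δ i * rI η ε₀ δ i ^ 2) + δ ≤ δ ^ (1 - 2 * η) ∧
        δ ^ (1 - 2 * η) + K * δ ≤ epsI ε₀ δ i / 2 := by
  set s₀ := min (min 1 (1 / (M + 2))) (min (1 / (2 * (K + 1))) (r₀ ^ 2)) with hs₀
  have hs₀pos : 0 < s₀ := by
    refine lt_min (lt_min one_pos (by positivity)) (lt_min (by positivity) (by positivity))
  refine ⟨min (s₀ ^ (1 / η)) ρ, lt_min (Real.rpow_pos_of_pos hs₀pos _) hρ, fun δ hδ hlt => ?_⟩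
  refine ⟨hlt.le.trans (min_le_right _ _), fun i hi => ?_⟩
  set s := δ ^ η with hs
  have hspos : 0 < s := Real.rpow_pos_of_pos hδ η
  have hss : s ≤ s₀ := by
    have := Real.rpow_le_rpow hδ.le (hlt.le.trans (min_le_left _ _)) hη.le
    rwa [← Real.rpow_mul hs₀pos.le, one_div_mul_cancel hη.ne', Real.rpow_one] at this
  have s1 : s ≤ 1 := hss.trans ((min_le_left _ _).trans (min_le_left _ _))
  have s2 : (M + 2) * s ≤ 1 := by
    rw [← le_div_iff₀' (by positivity)]
    exact hss.trans ((min_le_left _ _).trans (min_le_right _ _))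
  have s3 : 2 * (K + 1) * s ≤ 1 := by
    rw [← le_div_iff₀' (by positivity)]
    exact hss.trans ((min_le_right _ _).trans (min_le_left _ _))
  have s4 : s ≤ r₀ ^ 2 := hss.trans ((min_le_right _ _).trans (min_le_right _ _))
  set D := δ ^ (1 - 4 * η) with hD
  have hDpos : 0 < D := Real.rpow_pos_of_pos hδ _
  have p2 : δ ^ (1 - 2 * η) = D * s ^ 2 := by
    rw [hD, hs, ← Real.rpow_mul_natCast hδ.le, ← Real.rpow_add hδ]
    congr 1; push_cast; ring
  have p1 : δ ^ (1 - η) = D * s ^ 3 := by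
    rw [hD, hs, ← Real.rpow_mul_natCast hδ.le, ← Real.rpow_add hδ]
    congr 1; push_cast; ring
  have p0 : δ = D * s ^ 4 := by
    rw [hD, hs, ← Real.rpow_mul_natCast hδ.le, ← Real.rpow_add hδ]
    conv_lhs => rw [← Real.rpow_one δ]
    congr 1; push_cast; ring
  have hε : D ≤ epsI ε₀ δ i := by
    have h1 := Int.le_floor.1 hi
    rw [le_div_iff₀ hδ] at h1
    rw [epsI]
    push_cast at h1
    linarith
  have hεpos := hDpos.trans_le hε
  have hr2 : rI η ε₀ δ i ^ 2 = δ ^ (1 - η) / epsI ε₀ δ i := by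
    rw [rI, Real.sq_sqrt]
    exact div_nonneg (Real.rpow_nonneg hδ.le _) hεpos.le
  have q2 : s ^ 2 ≤ s := by nlinarith
  have q3 : s ^ 3 ≤ s ^ 2 := by nlinarith [sq_nonneg s]
  have q4 : s ^ 4 ≤ s ^ 3 := by nlinarith [pow_pos hspos 3]
  refine ⟨hεpos, ?_, Real.sqrt_nonneg _, ?_, ?_, ?_⟩
  · rw [epsI]
    have : 0 ≤ δ * i := by positivity
    linarith
  · refine Real.sqrt_le_iff.2 ⟨hr₀.le, ?_⟩
    rw [div_le_iff₀ hεpos, p1]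
    calc D * s ^ 3 ≤ epsI ε₀ δ i * r₀ ^ 2 :=
          mul_le_mul hε (by linarith) (by positivity) hεpos.le
      _ = _ := by ring
  · rw [hr2, mul_div_cancel₀ _ hεpos.ne', p1, p2]
    have : (M + 1) * s ^ 3 + s ^ 4 ≤ s ^ 2 := by
      calc (M + 1) * s ^ 3 + s ^ 4 ≤ ((M + 2) * s) * s ^ 2 := by nlinarith
        _ ≤ 1 * s ^ 2 := mul_le_mul_of_nonneg_right s2 (sq_nonneg s)
        _ = s ^ 2 := one_mul _
    linarith [mul_le_mul_of_nonneg_left this hDpos.le]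
  · rw [p2]
    have : s ^ 2 + K * s ^ 4 ≤ 1 / 2 := by nlinarith
    have e : K * δ = K * (D * s ^ 4) := by rw [← p0]
    linarith [mul_le_mul_of_nonneg_left this hDpos.le]

theorem continuousOn_pd_pd {U : Set Plane} {φ : Plane → ℝ} (hU : IsOpen U)
    (hφ : ContDiffOn ℝ 2 φ U) (j k : Fin 2) : ContinuousOn (pd j (pd k φ)) U := by
  have h1 : ContDiffOn ℝ 1 (pd k φ) U :=
    (hφ.fderiv_of_isOpen hU (by norm_num)).clm_apply contDiffOn_const
  have h0 : ContDiffOn ℝ 0 (pd j (pd k φ)) U :=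
    (h1.fderiv_of_isOpen hU (by norm_num)).clm_apply contDiffOn_const
  exact h0.continuousOn

theorem exists_pd_pd_bound {U V : Set Plane} {φ : Plane → ℝ} (hU : IsOpen U)
    (hφ : ContDiffOn ℝ 2 φ U) (hV : IsCompact V) (hVU : V ⊆ U) :
    ∃ H : ℝ, 0 ≤ H ∧ ∀ x ∈ V, ∀ j k, |pd j (pd k φ) x| ≤ H := by
  have h (j k : Fin 2) := hV.exists_bound_of_continuousOn ((continuousOn_pd_pd hU hφ j k).mono hVU)
  choose C hC using h
  refine ⟨∑ j, ∑ k, |C j k|, Finset.sum_nonneg fun j _ => Finset.sum_nonneg fun k _ => abs_nonneg _,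
    fun x hx j k => ((hC j k x hx).trans (le_abs_self _)).trans ?_⟩
  exact (Finset.single_le_sum (f := fun k => |C j k|) (fun _ _ => abs_nonneg _)
    (Finset.mem_univ k)).trans (Finset.single_le_sum (f := fun j => ∑ k, |C j k|)
    (fun _ _ => Finset.sum_nonneg fun _ _ => abs_nonneg _) (Finset.mem_univ j))

/-- The greatest height functions below a smooth barrier with slopes in the Newton polygon. -/
theorem isGreatest_floor {δ : ℝ} (hδ : 0 < δ) {A : Set Vertex} {F : Plane → ℝ}
    (h : IsHeight A fun x => ⌊F (pos δ x) / δ⌋) :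
    IsGreatest {h | IsHeight A h ∧ ∀ x : A, δ * (h x : ℝ) ≤ F (pos δ x)}
      fun x => ⌊F (pos δ x) / δ⌋ := by
  refine ⟨⟨h, fun x => ?_⟩, fun k hk x => ?_⟩
  · rw [← le_div_iff₀' hδ]
    exact Int.floor_le _
  · exact Int.le_floor.2 ((le_div_iff₀' hδ).2 (hk.2 x))

theorem exists_isGreatest_Omega {δ : ℝ} (hδ : 0 < δ) {A : Set Vertex} {F : Plane → ℝ}
    (h : IsHeight A fun x => ⌊F (pos δ x) / δ⌋) {g : Vertex → ℤ} (hne : (Omega A g).Nonempty)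
    (hg : ∀ x ∈ A, δ * g x ≤ F (pos δ x)) :
    ∃ k, IsGreatest {h | h ∈ Omega A g ∧ ∀ x : A, δ * (h x : ℝ) ≤ F (pos δ x)} k := by
  have e : {h | h ∈ Omega A g ∧ ∀ x : A, δ * (h x : ℝ) ≤ F (pos δ x)} =
      {h | h ∈ Omega A g ∧ ∀ x : A, h x ≤ ⌊F (pos δ x) / δ⌋} := by
    ext k
    simp only [mem_ofPred_eq, Int.le_floor, le_div_iff₀' hδ]
  rw [e]
  obtain ⟨h₀, hh₀, hb⟩ := hne
  -- The minimum of any admissible function with the rounded barrier is a competitor; its boundary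
  -- values are unchanged because `g` is below the barrier.
  refine exists_isGreatest ⟨fun x => min (h₀ x) ⌊F (pos δ x) / δ⌋, ⟨hh₀.min h, fun x hx => ?_⟩,
    fun x => min_le_right _ _⟩
  simp only [hb x hx]
  exact min_eq_left (Int.le_floor.2 ((le_div_iff₀' hδ).2 (hg x x.2)))

theorem exp_coord_le {ξ c : ℝ} {x : Plane} (h : 1 ≤ psi ξ c x) (j : Fin 2) :
    Real.exp (x j / ξ) ≤ c - 1 := by
  have h0 := Real.exp_pos (x 0 / ξ)
  have h1 := Real.exp_pos (x 1 / ξ)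
  simp only [psi] at h
  fin_cases j <;> simp only [Fin.zero_eta, Fin.mk_one] <;> linarith

/-- The slopes of `φ + ε ψ` stay in the Newton polygon for small `ε`. -/
theorem grad_add_psi_mem {φ : Plane → ℝ} {a ε P ξ c : ℝ} {x : Plane} (hφ : DifferentiableAt ℝ φ x)
    (hs : grad φ x ∈ slopes a) (hε : 0 ≤ ε) (hP : ∀ j, |pd j (psi ξ c) x| ≤ P)
    (hεa : ε * P ≤ a / 2) (ha : 0 ≤ a) : grad (fun y => φ y + ε * psi ξ c y) x ∈ slopes 0 := by
  have e (j : Fin 2) : pd j (fun y => φ y + ε * psi ξ c y) x = pd j φ x + ε * pd j (psi ξ c) x := by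
    rw [pd_of_hasFDerivAt (hφ.hasFDerivAt.fun_add
      ((differentiable_psi ξ c x).hasFDerivAt.const_mul ε))]
    rfl
  have hb (j : Fin 2) : |ε * pd j (psi ξ c) x| ≤ a / 2 := by
    rw [abs_mul, abs_of_nonneg hε]
    exact (mul_le_mul_of_nonneg_left (hP j) hε).trans hεa
  have b0 := abs_le.1 (hb 0)
  have b1 := abs_le.1 (hb 1)
  obtain ⟨h0, h1, h2⟩ := hs
  simp [grad] at h0 h1 h2
  refine ⟨?_, ?_, ?_⟩ <;> simp [grad, e] <;> linarith

end Lozenge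

/-! ### Choice of the constants and conclusion. -/

theorem mainTheorem8
    (U W : Set Plane) (hU : IsJordanDomain U) (hW : IsJordanDomain W) (hWU : closure W ⊆ U)
    (φ : Plane → ℝ) (a : ℝ) (ha : 0 < a) (hφ : IsLiquidShape U a φ)
    (K : ℝ) (hK : 0 < K)
    (ξ : ℝ) (hξ : 0 < ξ) (c : ℝ) (hc : IsGLB (psi ξ c '' U) 1) :
    ∃ εbar : ℝ, 0 < εbar ∧ ∀ ε₀ : ℝ, 0 < ε₀ → ε₀ < εbar → ∀ η : ℝ, 0 < η →
    ∃ δ₀ : ℝ, 0 < δ₀ ∧ ∀ δ : ℝ, 0 < δ → δ < δ₀ →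
    -- the boundary condition of the dynamics in `W`
    ∀ g : Vertex → ℤ, IsDiscretization K δ U φ g → (Omega (sites δ W) g).Nonempty →
    ∀ i : ℕ, (i : ℤ) ≤ iMax η ε₀ δ → ∀ (w : Vertex) (hw : w ∈ sites δ W),
    -- the limit shape `φ_{i,w}` in the ellipse `E_{i,w}`
    ∀ φiw : Plane → ℝ,
    IsLimitShape (ellipse ξ c (pos δ w) (rI η ε₀ δ i))
      (bdryDatum φ ξ c (epsI ε₀ δ i) (rI η ε₀ δ i) (pos δ w)) φiw →
    -- the maximal height functions below `φ + ε_i ψ`, in `W` and in the half-size ellipse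
    ∃ (hmax : sites δ W → ℤ)
      (hmax' : sites δ (ellipse ξ c (pos δ w) (rI η ε₀ δ i / 2)) → ℤ),
      IsGreatest {h | h ∈ Omega (sites δ W) g ∧ ∀ x : sites δ W,
        δ * (h x : ℝ) ≤ φ (pos δ x) + epsI ε₀ δ i * psi ξ c (pos δ x)} hmax ∧
      IsGreatest {h | IsHeight (sites δ (ellipse ξ c (pos δ w) (rI η ε₀ δ i / 2))) h ∧
        ∀ x : sites δ (ellipse ξ c (pos δ w) (rI η ε₀ δ i / 2)),
          δ * (h x : ℝ) ≤ φ (pos δ x) + epsI ε₀ δ i * psi ξ c (pos δ x)} hmax' ∧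
      probBelow δ (sites δ (ellipse ξ c (pos δ w) (rI η ε₀ δ i / 2)))
          (fun x => φiw x - δ ^ (1 - 2 * η))
          (fun x => φ x + epsI ε₀ δ i * psi ξ c x)
          hmax' ⟨w, center_mem ξ c δ (rI η ε₀ δ i / 2) w⟩
          (φ (pos δ w) + epsI ε₀ δ (i + 1) * psi ξ c (pos δ w))
          (Icc (tI η ε₀ δ (i + 1) - tI η ε₀ δ i) (δ ^ (-5 : ℝ) - tI η ε₀ δ i))
        ≤ probBelow δ (sites δ W)
          (fun x => φ x - epsI ε₀ δ i * psi ξ c x)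
          (fun x => φ x + epsI ε₀ δ i * psi ξ c x)
          hmax ⟨w, hw⟩
          (φ (pos δ w) + epsI ε₀ δ (i + 1) * psi ξ c (pos δ w))
          (Icc (tI η ε₀ δ (i + 1) - tI η ε₀ δ i) (δ ^ (-5 : ℝ) - tI η ε₀ δ i)) := by
  have hUo := hU.isOpen
  have hφ2 : ContDiffOn ℝ 2 φ U := contDiffOn_infty.1 hφ.smooth 2
  have hslope : ∀ x ∈ U, grad φ x ∈ slopes a := fun x hx =>
    mem_slopes_of_le_infDist (hφ.solves x hx).1 (hφ.nonfrozen x hx)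
  have hψ : ∀ x ∈ U, 1 ≤ psi ξ c x := fun x hx => hc.1 ⟨x, hx, rfl⟩
  have hc1 : 0 < c - 1 := by
    obtain ⟨_, x, hx, rfl⟩ := hc.nonempty
    exact (Real.exp_pos _).trans_le (exp_coord_le (hψ x hx) 0)
  set P := (c - 1) / ξ with hPdef
  have hP0 : 0 < P := div_pos hc1 hξ
  have hP : ∀ x ∈ U, ∀ j, |pd j (psi ξ c) x| ≤ P := by
    intro x hx j
    rw [pd_psi, abs_neg, abs_of_pos (div_pos (Real.exp_pos _) hξ)]
    exact div_le_div_of_nonneg_right (exp_coord_le (hψ x hx) j) hξ.le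
  have hWc : IsCompact (closure W) := hW.bounded.isCompact_closure
  obtain ⟨ρ, hρ, hρU⟩ := hWc.exists_cthickening_subset_open hUo hWU
  obtain ⟨H, hH0, hH⟩ := exists_pd_pd_bound hUo hφ2 hWc.cthickening hρU
  obtain ⟨R, hR⟩ := hW.bounded.subset_closedBall 0
  have hball : ∀ x ∈ W, ∀ ℓ ≤ ρ, Metric.closedBall x ℓ ⊆ Metric.cthickening ρ (closure W) :=
    fun x hx ℓ hℓ y hy => Metric.mem_cthickening_of_dist_le y x ρ _ (subset_closure hx)
      (le_trans hy hℓ)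
  set κ := Real.exp (-R / ξ) / ξ ^ 2 with hκdef
  have hκ : 0 < κ := div_pos (Real.exp_pos _) (by positivity)
  have hκw : ∀ x ∈ W, ∀ j, κ ≤ curv ξ x j := by
    intro x hx j
    refine div_le_div_of_nonneg_right (Real.exp_le_exp.2 (div_le_div_of_nonneg_right ?_ hξ.le))
      (by positivity)
    have := (abs_le.1 ((abs_coord_sub_le_dist x 0 j).trans (hR hx))).1
    simpa using this
  set κ' := (c - 1) / ξ ^ 2 with hκ'def
  have hκ' : 0 < κ' := div_pos hc1 (by positivity)
  have hκw' : ∀ x ∈ U, ∀ j, curv ξ x j ≤ κ' := fun x hx j =>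
    div_le_div_of_nonneg_right (exp_coord_le (hψ x hx) j) (by positivity)
  -- The first term balances the change of coefficients; adding `1` makes the inequality strict,
  -- also when `H = 0`.
  set M := 12 * H * Real.pi * (P + 1) / (4 * κ * a ^ 3) + 1 with hMdef
  have hM : 0 < M := by positivity
  have hMH : 12 * H * Real.pi * (P + 1) < 4 * M * κ * a ^ 3 := by
    have : 4 * M * κ * a ^ 3 = 12 * H * Real.pi * (P + 1) + 4 * κ * a ^ 3 := by
      rw [hMdef]; field_simp
    rw [this]
    have : 0 < 4 * κ * a ^ 3 := by positivity
    linarith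
  refine ⟨a / (4 * (P + 1)), by positivity, fun ε₀ _ hε₀ η hη => ?_⟩
  rw [lt_div_iff₀ (by positivity)] at hε₀
  -- Bounds for the size of the ellipse: it stays in the `ρ`-neighbourhood of the closure of `W`,
  -- the bump has small slope, the Taylor bound for `ψ` applies, and the linear part of `ψ` varies
  -- little.
  set ℓ₀ := min (min ρ (1 / (2 * M * κ'))) (min ξ (1 / (8 * P))) with hℓ₀
  have hℓ₀pos : 0 < ℓ₀ := lt_min (lt_min hρ (by positivity)) (lt_min hξ (by positivity))
  obtain ⟨δ₀, hδ₀, hscale⟩ := exists_scale (ε₀ := ε₀) (M := M) (K := K)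
    (r₀ := min (ℓ₀ * Real.sqrt κ) (1 / (2 * (M + 1)))) (ρ := ρ / 2) hη hM.le hK
    (lt_min (mul_pos hℓ₀pos (Real.sqrt_pos.2 hκ)) (by positivity)) (by positivity)
  refine ⟨δ₀, hδ₀, fun δ hδ hδlt g hg hne i hi w hw u hu => ?_⟩
  obtain ⟨hδρ, hsc⟩ := hscale δ hδ hδlt
  obtain ⟨hε, hεε₀, hr, hrr₀, hs1, hs2⟩ := hsc i hi
  set ε := epsI ε₀ δ i
  set r := rI η ε₀ δ i
  have hℓ : r / Real.sqrt κ ≤ ℓ₀ := by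
    rw [div_le_iff₀ (Real.sqrt_pos.2 hκ)]
    exact hrr₀.trans (min_le_left _ _)
  have hℓρ : r / Real.sqrt κ ≤ ρ := hℓ.trans ((min_le_left _ _).trans (min_le_left _ _))
  have hwB := hball (pos δ w) hw _ hℓρ
  have hwU : pos δ w ∈ U := hWU (subset_closure hw)
  have hεa : ε * (P + 1) ≤ a / 4 := by
    have := mul_le_mul_of_nonneg_right hεε₀ (by positivity : 0 ≤ P + 1)
    linarith
  have hr3 : (M + 1) * r ^ 2 ≤ 1 / 4 := by
    have h1 : r ≤ 1 / (2 * (M + 1)) := hrr₀.trans (min_le_right _ _)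
    rw [le_div_iff₀ (by positivity)] at h1
    have h2 : r * (M + 1) ≤ 1 / 2 := by linarith
    have h3 : r ≤ 1 / 2 := le_trans (by nlinarith) h2
    calc (M + 1) * r ^ 2 = r * (M + 1) * r := by ring
      _ ≤ 1 / 2 * (1 / 2) := mul_le_mul h2 h3 hr (by norm_num)
      _ = 1 / 4 := by norm_num
  have hbounds := fun x (hx : x ∈ ellipse ξ c (pos δ w) r) =>
    limitShape_bounds hUo hφ2 hφ.solves ha hslope hξ
    (hwB.trans hρU) (fun x hx => hH x (hwB hx)) hu hr hκ (hκw _ hw) (hκw' _ hwU) (hP _ hwU) hε hεa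
    hM.le hMH (by
      have := hℓ.trans ((min_le_left _ _).trans (min_le_right _ _))
      rwa [le_div_iff₀' (by positivity)] at this)
    (hℓ.trans ((min_le_right _ _).trans (min_le_left _ _))) hr3 (by
      have := hℓ.trans ((min_le_right _ _).trans (min_le_right _ _))
      rw [le_div_iff₀' (by positivity)] at this
      linarith) (hψ _ hwU) hx
  set up : Plane → ℝ := fun x => φ x + ε * psi ξ c x with hup
  have hφd : ∀ x ∈ U, DifferentiableAt ℝ φ x := fun x hx =>
    (hφ2.contDiffAt (hUo.mem_nhds hx)).differentiableAt two_ne_zero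
  have hupd : ∀ x ∈ U, DifferentiableAt ℝ up x := fun x hx =>
    (hφd x hx).add ((differentiable_psi ξ c x).const_mul ε)
  have hups : ∀ x ∈ U, grad up x ∈ slopes 0 := fun x hx =>
    grad_add_psi_mem (hφd x hx) (hslope x hx) hε.le (hP x hx) (by linarith) ha.le
  have hheightW : IsHeight (sites δ W) fun x => ⌊up (pos δ x) / δ⌋ := by
    refine isHeight_floor hδ hupd hups fun x hx y hy hxy => ?_
    -- `W` need not be convex, so an edge between two sites of `W` may leave `W`. Having length at
    -- most `2δ ≤ ρ`, it stays in `U`.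
    refine Subset.trans ?_ ((hball (pos δ x) hx ρ le_rfl).trans hρU)
    exact (convex_closedBall _ _).segment_subset
      (Metric.mem_closedBall.2 ((dist_pos_le_of_nbr hδ hxy).trans (by linarith)))
      (Metric.mem_closedBall_self hρ.le)
  have hEB : ellipse ξ c (pos δ w) (r / 2) ⊆ Metric.closedBall (pos δ w) (r / Real.sqrt κ) :=
    ellipse_half_subset.trans (ellipse_subset_closedBall hκ hr (hκw _ hw))
  have hheightE : IsHeight (sites δ (ellipse ξ c (pos δ w) (r / 2)))
      fun x => ⌊up (pos δ x) / δ⌋ :=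
    isHeight_floor hδ hupd hups fun x hx y hy _ =>
      ((convex_closedBall _ _).segment_subset (hEB hy) (hEB hx)).trans (hwB.trans hρU)
  have hgφ : ∀ x ∈ sites δ W, δ * g x ≤ φ (pos δ x) + K * δ := fun x hx => by
    have := (abs_le.1 (hg x (hWU (subset_closure hx)))).2
    linarith
  have hD : 0 < δ ^ (1 - 2 * η) := Real.rpow_pos_of_pos hδ _
  have hεψ : ∀ x ∈ U, ε ≤ ε * psi ξ c x := fun x hx => le_mul_of_one_le_right hε.le (hψ x hx)
  obtain ⟨hmax, hgreat⟩ := exists_isGreatest_Omega hδ hheightW hne fun x hx => by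
    have h1 := hgφ x hx
    have h2 := hεψ _ (hWU (subset_closure hx))
    simp only [hup]
    linarith
  have hgreat' := isGreatest_floor hδ hheightE
  refine ⟨hmax, _, hgreat, hgreat', ?_⟩
  refine probBelow_le_probBelow hδ (finite_sites hδ hW.bounded)
    (finite_sites hδ (Metric.isBounded_closedBall.subset hEB))
    ⟨hgreat.1.1.1, fun _ _ => rfl, hgreat.1.2⟩ ⟨hheightE, fun _ _ => rfl, hgreat'.1.2⟩
    (fun x => ?_) (fun x hxW hxE => ?_) (fun x hxW hxE => ?_) (fun x v hv => ?_) w hw _ _ _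
  -- The margin `δ^{1-2η}` absorbs the excess of order `ε r²` of the limit shape over the ceiling
  -- and the rounding error `δ`.
  · have h1 := (hbounds _ (ellipse_half_subset x.2)).2
    have h2 : up (pos δ x) - δ < δ * ⌊up (pos δ x) / δ⌋ := by
      have := Int.lt_floor_add_one (up (pos δ x) / δ)
      rw [div_lt_iff₀' hδ] at this
      linarith
    simp only [hup] at h2 ⊢
    linarith
  · have h1 := (hbounds _ (ellipse_half_subset hxE)).1
    have h2 := hεψ _ (hWU (subset_closure hxW))
    have : 0 < K * δ := by positivity
    linarith
  -- This is where `w` near the boundary matters: the gap `ε/2` above `φ` exceeds `δ^{1-2η} + Kδ`,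
  -- so the boundary heights of `W` lie below the floor of the ellipse dynamics.
  · have h1 := (hbounds _ (ellipse_half_subset hxE)).1
    rw [hgreat.1.1.2 x hxW]
    have h2 := hgφ x x.2
    linarith
  · exact Int.le_floor.2 ((le_div_iff₀' hδ).2 hv)
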